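/- Let $M$ be a smooth $n$-dimensional oriented spacetime with smooth Lorentzian metric $g_{ab}$ of signature $(-,+,\dots,+)$ and volume form $\epsilon$, let $0\le p\le n$, and let $*$ be the Hodge dual, $(*F)_{b_1\dots b_{n-p}}=\frac1{p!}\,\epsilon^{a_1\dots a_p}{}_{b_1\dots b_{n-p}}F_{a_1\dots a_p}$. Let $F$ be a smooth $p$-form on $M$ that is null (of type N), i.e. at every point there is a vector $\ell\neq0$ with $\ell^aF_{ab_1\dots b_{p-1}}=0$ and $\ell_{[a}F_{b_1\dots b_p]}=0$, and that solves the source-free Maxwell equations $\mathrm dF=0$, $\mathrm d{*F}=0$. Say that a tensor field is constructed algebraically and polynomially from $F$ if it is obtained from $F$, $*F$, the metric and the volume form by finitely many sums, tensor products, index permutations, metric contractions and multiplications by scalar coefficients. The coefficients are smooth functions on $M$ that are constants or, more generally, functions $f(I_1,\dots,I_m)$ of finitely many scalar invariants $I_j$ constructed in the same way; $f$ itself is arbitrary. Then $F$ is 0-universal: $\mathrm dF=0$, and $\mathrm d{*\tilde F}=0$ for every $p$-form $\tilde F$ constructed algebraically and polynomially from $F$. Moreover every such $\tilde F$ is also closed,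 so it is a smooth $p$-form with $\mathrm d\tilde F=0$ and $\mathrm d{*\tilde F}=0$. -/

import Mathlib

open scoped Manifold ContDiff Bundle
open Bundle

noncomputable section

/-! ### Pointwise algebra: a finite-dimensional space `V` with a basis `b` and a scalar product `B`

The constructions below use a basis to write out index contractions; as usual, for a nondegenerate
`B` the results do not depend on which basis is used. -/

section Pointwise

variable {n p q k l : ℕ} {V : Type*} [AddCommGroup V] [Module ℝ V] [TopologicalSpace V]

/-- The components `B^{ij}` of the inverse of the scalar product `B_{ij} = B (b i) (b j)`. -/
def inverseGram (b : Module.Basis (Fin n) ℝ V) (B : V →L[ℝ] V →L[ℝ] ℝ) :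
    Matrix (Fin n) (Fin n) ℝ :=
  (Matrix.of fun i j => B (b i) (b j))⁻¹

/-- Covariant tensors of rank `k` on `V`. -/
abbrev CovTensor (k : ℕ) (V : Type*) [AddCommGroup V] [Module ℝ V] : Type _ :=
  MultilinearMap ℝ (fun _ : Fin k => V) ℝ

/-- A scalar product as a covariant tensor of rank 2. -/
def scalarProductTensor (B : V →L[ℝ] V →L[ℝ] ℝ) : CovTensor 2 V where
  toFun v := B (v 0) (v 1)
  map_update_add' v i x y := by
    fin_cases i <;> simp
  map_update_smul' v i c x := by
    fin_cases i <;> simp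

/-- The tensor product `(S ⊗ T) (v₁, …, v_{k+l}) = S (v₁, …, v_k) * T (v_{k+1}, …, v_{k+l})`. -/
def CovTensor.prod (S : CovTensor k V) (T : CovTensor l V) : CovTensor (k + l) V :=
  (LinearMap.mul' ℝ ℝ).compMultilinearMap ((S.domCoprod T).domDomCongr finSumFinEquiv)

/-- The metric contraction `B^{ij} T_{i j a₁ … a_k}` of the first two indices of a tensor. -/
def CovTensor.contract (b : Module.Basis (Fin n) ℝ V) (B : V →L[ℝ] V →L[ℝ] ℝ)
    (T : CovTensor (k + 2) V) : CovTensor k V :=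
  ∑ i, ∑ j, inverseGram b B i j • (T.curryLeft (b i)).curryLeft (b j)

theorem append_update_right {V : Type*} {p q : ℕ} [DecidableEq (Fin q)] (a : Fin p → V)
    (v : Fin q → V) (i : Fin q) (z : V) :
    Fin.append a (Function.update v i z) =
      Function.update (Fin.append a v) (Fin.natAdd p i) z := by
  ext j
  refine Fin.addCases (fun j => ?_) (fun j => ?_) j
  · rw [Function.update_of_ne (by simp [Fin.ext_iff]; omega)]
    simp
  · by_cases hj : j = i
    · subst hj; simp
    · rw [Function.update_of_ne (by simpa [Fin.ext_iff] using hj)]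
      simp [hj]

/-- The `q`-form `v ↦ ε (a₁, …, a_p, v₁, …, v_q)`. -/
def insertFirst (h : p + q = n) (ε : V [⋀^Fin n]→L[ℝ] ℝ) (a : Fin p → V) :
    V [⋀^Fin q]→L[ℝ] ℝ where
  toFun v := ε (fun i => Fin.append a v (Fin.cast h.symm i))
  map_update_add' v i x y := by
    subst h
    simp [append_update_right]
  map_update_smul' v i c x := by
    subst h
    simp [append_update_right]
  map_eq_zero_of_eq' v i j hij hne := by
    subst h
    exact ε.map_eq_zero_of_eq _ (i := Fin.natAdd p i) (j := Fin.natAdd p j) (by simpa using hij)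
      (by simpa [Fin.ext_iff] using hne)
  cont := by
    subst h
    refine ε.cont.comp (continuous_pi fun i => ?_)
    refine Fin.addCases (fun i => ?_) (fun i => ?_) i
    · simpa using continuous_const
    · simpa using continuous_apply i

/-- The Hodge dual
`(*F)_{c₁ … c_q} = (1 / p!) ε^{a₁ … a_p}_{c₁ … c_q} F_{a₁ … a_p}`
of a `p`-form `F`, with respect to the scalar product `B` and the volume form `ε`. -/
def hodgeDual (h : p + q = n) (b : Module.Basis (Fin n) ℝ V) (B : V →L[ℝ] V →L[ℝ] ℝ)
    (ε : V [⋀^Fin n]→L[ℝ] ℝ) (F : V [⋀^Fin p]→L[ℝ] ℝ) : V [⋀^Fin q]→L[ℝ] ℝ :=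
  ((p.factorial : ℝ)⁻¹) • ∑ i : Fin p → Fin n, ∑ j : Fin p → Fin n,
    ((∏ s, inverseGram b B (i s) (j s)) * F (fun s => b (j s))) •
      insertFirst h ε (fun s => b (i s))

/-- A `p`-form `F` is null (of type N) with respect to the scalar product `B` if there is a
vector `ℓ ≠ 0` with `ℓ^a F_{a b₂ … b_p} = 0` and `ℓ_{[a} F_{b₁ … b_p]} = 0`. The second
condition is written as the vanishing of the wedge product of `ℓ_a = B (ℓ, ·)` with `F`. -/
def IsNullAt (B : V →L[ℝ] V →L[ℝ] ℝ) (F : V [⋀^Fin p]→L[ℝ] ℝ) : Prop :=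
  ∃ ℓ : V, ℓ ≠ 0 ∧
    (∀ v : Fin p → V, (∃ i, v i = ℓ) → F v = 0) ∧
    (∀ v : Fin (p + 1) → V,
      ∑ i : Fin (p + 1), (-1 : ℝ) ^ (i : ℕ) * B ℓ (v i) * F (i.removeNth v) = 0)

end Pointwise

/-! ### Differential forms on an `n`-dimensional manifold -/

section Manifold

/-- The coordinate space `ℝⁿ` on which `n`-dimensional manifolds are modelled. -/
abbrev ModelSpace (n : ℕ) : Type := EuclideanSpace ℝ (Fin n)

/-- Differential forms of degree `p` (with no regularity required). -/
abbrev FormField (n : ℕ) (M : Type*) [TopologicalSpace M] [ChartedSpace (ModelSpace n) M]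
    (p : ℕ) : Type _ :=
  (x : M) → TangentSpace (𝓡 n) x [⋀^Fin p]→L[ℝ] ℝ

/-- Covariant tensor fields of rank `k` (with no regularity required). -/
abbrev CovTensorField (n : ℕ) (M : Type*) [TopologicalSpace M] [ChartedSpace (ModelSpace n) M]
    (k : ℕ) : Type _ :=
  (x : M) → CovTensor k (TangentSpace (𝓡 n) x)

variable {n p q : ℕ} {M : Type*} [TopologicalSpace M] [ChartedSpace (ModelSpace n) M]

/-- The coordinate expression of a form in a chart `e`: its pullback by `e.symm`. It is
meaningful on `e.target`. -/
def FormField.inChart (α : FormField n M p) (e : OpenPartialHomeomorph M (ModelSpace n))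
    (y : ModelSpace n) : ModelSpace n [⋀^Fin p]→L[ℝ] ℝ :=
  (α (e.symm y)).compContinuousLinearMap (mfderiv (𝓡 n) (𝓡 n) e.symm y)

/-- A form is smooth if its coordinate expressions in all the charts of the atlas are. -/
def FormField.IsSmooth (α : FormField n M p) : Prop :=
  ∀ e ∈ atlas (ModelSpace n) M, ContDiffOn ℝ ∞ (α.inChart e) e.target

/-- The exterior derivative: at `x`, take the exterior derivative of the coordinate expression
in the preferred chart at `x`, and pull it back to `M`. -/
def FormField.d (α : FormField n M p) : FormField n M (p + 1) := fun x =>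
  (extDeriv (α.inChart (chartAt (ModelSpace n) x)) (chartAt (ModelSpace n) x x)).compContinuousLinearMap
    (mfderiv (𝓡 n) (𝓡 n) (chartAt (ModelSpace n) x) x)

/-- A (smooth) closed form. -/
def FormField.IsClosed (α : FormField n M p) : Prop :=
  α.IsSmooth ∧ α.d = 0

/-- A form as a covariant tensor field. -/
def FormField.toTensor (α : FormField n M p) : CovTensorField n M p :=
  fun x => (α x).toMultilinearMap

/-- The basis of the tangent space at `x` used to write out contractions: the standard basis,
under the identification of the tangent space with `ℝⁿ`. -/
def tangentBasis (x : M) : Module.Basis (Fin n) ℝ (TangentSpace (𝓡 n) x) :=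
  (EuclideanSpace.basisFun (Fin n) ℝ).toBasis

end Manifold

/-! ### Oriented spacetimes -/

section Spacetime

/-- A smooth Lorentzian metric of signature `(-, +, …, +)`, together with the volume form `ε` of
an orientation, that is, a smooth `n`-form with `ε (v₁, …, v_n) ^ 2 = |det g (v_i, v_j)|`. -/
structure OrientedSpacetime (n : ℕ) (M : Type*) [TopologicalSpace M]
    [ChartedSpace (ModelSpace n) M] [IsManifold (𝓡 n) ∞ M] where
  metric (x : M) : TangentSpace (𝓡 n) x →L[ℝ] TangentSpace (𝓡 n) x →L[ℝ] ℝ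
  contMDiff_metric :
    ContMDiff (𝓡 n) ((𝓡 n).prod 𝓘(ℝ, ModelSpace n →L[ℝ] ModelSpace n →L[ℝ] ℝ)) ∞
      (fun x => TotalSpace.mk' (ModelSpace n →L[ℝ] ModelSpace n →L[ℝ] ℝ)
        (E := fun x : M => TangentSpace (𝓡 n) x →L[ℝ] TangentSpace (𝓡 n) x →L[ℝ] ℝ)
        x (metric x))
  lorentzian (x : M) : ∃ (t : Fin n) (e : Module.Basis (Fin n) ℝ (TangentSpace (𝓡 n) x)),
    ∀ i j, metric x (e i) (e j) = if i = j then (if i = t then -1 else 1) else 0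
  vol : FormField n M n
  isSmooth_vol : vol.IsSmooth
  vol_sq (x : M) (v : Fin n → TangentSpace (𝓡 n) x) :
    vol x v ^ 2 = |(Matrix.of fun i j => metric x (v i) (v j)).det|

variable {n p q : ℕ} {M : Type*} [TopologicalSpace M] [ChartedSpace (ModelSpace n) M]
  [IsManifold (𝓡 n) ∞ M]

/-- The Hodge dual of a form. -/
def OrientedSpacetime.star (S : OrientedSpacetime n M) (h : p + q = n) (F : FormField n M p) :
    FormField n M q :=
  fun x => hodgeDual h (tangentBasis x) (S.metric x) (S.vol x) (F x)

/-- A form is null if it is null at every point. -/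
def OrientedSpacetime.IsNull (S : OrientedSpacetime n M) (F : FormField n M p) : Prop :=
  ∀ x, IsNullAt (S.metric x) (F x)

/-- The source-free Maxwell equations `dF = 0` and `d * F = 0`. -/
def OrientedSpacetime.SolvesMaxwell (S : OrientedSpacetime n M) (h : p + q = n)
    (F : FormField n M p) : Prop :=
  F.IsClosed ∧ (S.star h F).IsClosed

/-- `S.AlgebraicPolynomial h F T` says that the tensor field `T` is constructed algebraically and
polynomially from `F` and `*F`: it is obtained from `F`, `*F`, the metric and the volume form by
sums, tensor products, index permutations and metric contractions, and by multiplication with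
scalar coefficients. A scalar coefficient is a smooth function `c` on the spacetime that is a
constant or, more generally, an arbitrary function `f` of finitely many scalar invariants
`I₀, …, I_{m-1}` (tensors of rank 0) that are themselves constructed in this way. -/
inductive OrientedSpacetime.AlgebraicPolynomial (S : OrientedSpacetime n M) (h : p + q = n)
    (F : FormField n M p) : ∀ {k : ℕ}, CovTensorField n M k → Prop
  | field : S.AlgebraicPolynomial h F F.toTensor
  | dual : S.AlgebraicPolynomial h F (S.star h F).toTensor
  | metric : S.AlgebraicPolynomial h F (fun x => scalarProductTensor (S.metric x))
  | volume : S.AlgebraicPolynomial h F S.vol.toTensor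
  | add {k : ℕ} {T U : CovTensorField n M k} (hT : S.AlgebraicPolynomial h F T)
      (hU : S.AlgebraicPolynomial h F U) :
      S.AlgebraicPolynomial h F (fun x => T x + U x)
  | prod {k l : ℕ} {T : CovTensorField n M k} {U : CovTensorField n M l}
      (hT : S.AlgebraicPolynomial h F T) (hU : S.AlgebraicPolynomial h F U) :
      S.AlgebraicPolynomial h F (fun x => (T x).prod (U x))
  | perm {k : ℕ} {T : CovTensorField n M k} (σ : Equiv.Perm (Fin k))
      (hT : S.AlgebraicPolynomial h F T) :
      S.AlgebraicPolynomial h F (fun x => (T x).domDomCongr σ)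
  | contract {k : ℕ} {T : CovTensorField n M (k + 2)} (hT : S.AlgebraicPolynomial h F T) :
      S.AlgebraicPolynomial h F (fun x => (T x).contract (tangentBasis x) (S.metric x))
  | smul {k m : ℕ} {T : CovTensorField n M k} (I : Fin m → CovTensorField n M 0)
      (hI : ∀ i, S.AlgebraicPolynomial h F (I i)) (f : (Fin m → ℝ) → ℝ) (c : M → ℝ)
      (hc : ContMDiff (𝓡 n) 𝓘(ℝ, ℝ) ∞ c) (hcf : ∀ x, c x = f (fun i => I i x Fin.elim0))
      (hT : S.AlgebraicPolynomial h F T) :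
      S.AlgebraicPolynomial h F (fun x => c x • T x)

/-- A `p`-form `F` is 0-universal if `dF = 0`, and `d * G = 0` for every `p`-form `G` constructed
algebraically and polynomially from `F`. -/
def OrientedSpacetime.IsZeroUniversal (S : OrientedSpacetime n M) (h : p + q = n)
    (F : FormField n M p) : Prop :=
  F.IsClosed ∧ ∀ G : FormField n M p, S.AlgebraicPolynomial h F G.toTensor →
    (S.star h G).IsClosed

end Spacetime

end

/-! In an orthonormal frame, a tensor constructed from `F` is given by an operation `P ε F` that is
differentiable in `F` and commutes with the isometries of Minkowski space (`IsNaturalOperation`,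
`Represents`). The proof determines what such an operation can be on null forms when its values are
forms.

A nonzero null `F` has an isotropic `ℓ`, and the boosts in a null plane containing `ℓ` fix the
volume form and multiply `F` by any prescribed `c > 0` (`IsNullAt.exists_boosts`). Hence `P ε (c •
F)` is `P ε F` evaluated on boosted vectors. For scalars this gives `P ε (c • F) = P ε F`, and `c →
0` shows that every scalar invariant is a constant (`scalar_eq`). So the coefficients `f(I₁, …,
I_m)` are constants for arbitrary `f`, and no regularity of `f` is needed.

For a form-valued operation `Q`, each of the two null basis vectors occurs at most once among the
arguments of a component, so `Q ε (c • F)` scales componentwise by `1`, `c` or `c⁻¹`. Continuity at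
`c = 0` kills the last case, and differentiability at `0` then gives `Q ε F = Q ε 0 + linearize ε F`
(`eq_add_linearize`).

The linear part splits into an orientation-even and an orientation-odd piece. By Schur's lemma for
the Lorentz group (`IsEquivariant.exists_eq_smul`) the even piece is a multiple of the identity, or
zero if the degrees differ. Composition with the Hodge dual reduces the odd piece to the even case,
so it is a multiple of `*F` or zero. The term `Q ε 0` is a constant, a multiple of the volume form,
or zero. Every form obtained is thus a constant-coefficient combination of closed forms
(`Represents.isClosed`). This applies to `G` and to `*G` alike. -/

noncomputable section

/-! ### Basis independence and naturality of contractions and of the Hodge dual. -/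

section Naturality

variable {n p q k : ℕ} {V : Type*} [AddCommGroup V] [Module ℝ V] [TopologicalSpace V]
  {W : Type*} [AddCommGroup W] [Module ℝ W] [TopologicalSpace W]

theorem sum_comm_pairs {α β γ δ : Type*} [Fintype α] [Fintype β] [Fintype γ] [Fintype δ]
    {A : Type*} [AddCommMonoid A] (g : α → β → γ → δ → A) :
    ∑ i, ∑ j, ∑ k, ∑ l, g i j k l = ∑ k, ∑ l, ∑ i, ∑ j, g i j k l :=
  calc _ = ∑ x : α × β, ∑ y : γ × δ, g x.1 x.2 y.1 y.2 := by simp [Fintype.sum_prod_type]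
    _ = _ := by rw [Finset.sum_comm]; simp [Fintype.sum_prod_type]

theorem inverseGram_pullback (b : Module.Basis (Fin n) ℝ W) {B : V →L[ℝ] V →L[ℝ] ℝ}
    {B' : W →L[ℝ] W →L[ℝ] ℝ} {E : W ≃L[ℝ] V} (hE : ∀ v w, B (E v) (E w) = B' v w) :
    inverseGram b B' = inverseGram (b.map E.toLinearEquiv) B := by
  simp [inverseGram, hE]

/-- The Gram matrix changes by congruence with the transition matrix, and inverting gives the
contravariant law. Nondegeneracy is not required, since `Matrix.mul_inv_rev` is unconditional. -/
theorem inverseGram_change (b c : Module.Basis (Fin n) ℝ V) (B : V →L[ℝ] V →L[ℝ] ℝ) :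
    inverseGram b B = b.toMatrix c * inverseGram c B * (b.toMatrix c).transpose := by
  have hM : (Matrix.of fun i j => B (c i) (c j)) =
      (b.toMatrix c).transpose * (Matrix.of fun i j => B (b i) (b j)) * b.toMatrix c := by
    ext k l
    have h : ∀ k, c k = ∑ i, b.toMatrix c i k • b i := fun k => (b.sum_toMatrix_smul_self c k).symm
    simp only [Matrix.of_apply, Matrix.mul_apply, Matrix.transpose_apply, Finset.sum_mul]
    rw [h k, h l]
    simp only [map_sum, map_smul, sum_apply, smul_apply, smul_eq_mul, Finset.mul_sum]
    refine Finset.sum_congr rfl fun i _ => Finset.sum_congr rfl fun j _ => by ring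
  have hu : IsUnit (b.toMatrix c).det := by
    have := b.toMatrix_mul_toMatrix_flip c
    exact Matrix.isUnit_det_of_right_inverse this
  have hu' : IsUnit (b.toMatrix c).transpose.det := by rwa [Matrix.det_transpose]
  unfold inverseGram
  rw [hM, Matrix.mul_inv_rev, Matrix.mul_inv_rev, ← Matrix.mul_assoc, ← Matrix.mul_assoc,
    Matrix.mul_nonsing_inv _ hu, Matrix.one_mul, Matrix.mul_assoc, Matrix.nonsing_inv_mul _ hu',
    Matrix.mul_one]

/-- The contraction of a pair of `p`-linear maps does not depend on the basis. -/
theorem sum_prod_inverseGram_change (b c : Module.Basis (Fin n) ℝ V) (B : V →L[ℝ] V →L[ℝ] ℝ)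
    (f : MultilinearMap ℝ (fun _ : Fin p => V)
      (MultilinearMap ℝ (fun _ : Fin p => V) ℝ)) :
    ∑ i : Fin p → Fin n, ∑ j : Fin p → Fin n,
        (∏ s, inverseGram c B (i s) (j s)) * f (fun s => c (i s)) (fun s => c (j s)) =
      ∑ i : Fin p → Fin n, ∑ j : Fin p → Fin n,
        (∏ s, inverseGram b B (i s) (j s)) * f (fun s => b (i s)) (fun s => b (j s)) := by
  have h : ∀ k, c k = ∑ i, b.toMatrix c i k • b i := fun k => (b.sum_toMatrix_smul_self c k).symm
  have hf : ∀ i j : Fin p → Fin n, f (fun s => c (i s)) (fun s => c (j s)) =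
      ∑ k : Fin p → Fin n, ∑ l : Fin p → Fin n,
        (∏ s, b.toMatrix c (k s) (i s)) * ((∏ s, b.toMatrix c (l s) (j s)) *
          f (fun s => b (k s)) (fun s => b (l s))) := by
    intro i j
    simp only [h, MultilinearMap.map_sum, MultilinearMap.map_smul_univ, sum_apply,
      smul_apply, smul_eq_mul, Finset.mul_sum]
  have hG : ∀ k l : Fin p → Fin n, ∏ s, inverseGram b B (k s) (l s) =
      ∑ i : Fin p → Fin n, ∑ j : Fin p → Fin n, (∏ s, inverseGram c B (i s) (j s)) *
        ((∏ s, b.toMatrix c (k s) (i s)) * (∏ s, b.toMatrix c (l s) (j s))) := by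
    intro k l
    rw [inverseGram_change b c B]
    simp only [Matrix.mul_apply, Matrix.transpose_apply, Finset.sum_mul]
    rw [Finset.prod_univ_sum, Fintype.piFinset_univ, Finset.sum_comm]
    refine Finset.sum_congr rfl fun j _ => ?_
    rw [Finset.prod_univ_sum, Fintype.piFinset_univ]
    refine Finset.sum_congr rfl fun i _ => ?_
    rw [← Finset.prod_mul_distrib, ← Finset.prod_mul_distrib]
    refine Finset.prod_congr rfl fun s _ => by ring
  simp only [hf, hG, Finset.mul_sum, Finset.sum_mul]
  rw [sum_comm_pairs]
  refine Finset.sum_congr rfl fun k _ => Finset.sum_congr rfl fun l _ =>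
    Finset.sum_congr rfl fun i _ => Finset.sum_congr rfl fun j _ => by ring

theorem sum_inverseGram_change (b c : Module.Basis (Fin n) ℝ V) (B : V →L[ℝ] V →L[ℝ] ℝ)
    (f : V →ₗ[ℝ] V →ₗ[ℝ] ℝ) :
    ∑ i, ∑ j, inverseGram c B i j * f (c i) (c j) =
      ∑ i, ∑ j, inverseGram b B i j * f (b i) (b j) := by
  have h : ∀ k, c k = ∑ i, b.toMatrix c i k • b i := fun k => (b.sum_toMatrix_smul_self c k).symm
  have hf : ∀ i j, f (c i) (c j) =
      ∑ k, ∑ l, b.toMatrix c k i * b.toMatrix c l j * f (b k) (b l) := by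
    intro i j
    rw [h i, h j]
    simp only [map_sum, map_smul, LinearMap.sum_apply, LinearMap.smul_apply, smul_eq_mul,
      Finset.mul_sum]
    rw [Finset.sum_comm]
    refine Finset.sum_congr rfl fun k _ => Finset.sum_congr rfl fun l _ => by ring
  have hG : ∀ k l, inverseGram b B k l =
      ∑ i, ∑ j, b.toMatrix c k i * inverseGram c B i j * b.toMatrix c l j := by
    intro k l
    rw [inverseGram_change b c B, Finset.sum_comm]
    simp only [Matrix.mul_apply, Matrix.transpose_apply, Finset.sum_mul]
  simp only [hf, hG, Finset.mul_sum, Finset.sum_mul]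
  rw [sum_comm_pairs]
  refine Finset.sum_congr rfl fun k _ => Finset.sum_congr rfl fun l _ =>
    Finset.sum_congr rfl fun i _ => Finset.sum_congr rfl fun j _ => by ring

theorem contract_change (b c : Module.Basis (Fin n) ℝ V) (B : V →L[ℝ] V →L[ℝ] ℝ)
    (T : CovTensor (k + 2) V) : T.contract c B = T.contract b B := by
  ext v
  let apply_v : CovTensor k V →ₗ[ℝ] ℝ :=
    { toFun g := g v, map_add' _ _ := rfl, map_smul' _ _ := rfl }
  let f : V →ₗ[ℝ] V →ₗ[ℝ] ℝ :=
    LinearMap.mk₂ ℝ (fun x y => (T.curryLeft x).curryLeft y v)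
      (fun _ _ _ => by simp) (fun _ _ _ => by simp) (fun _ _ _ => by simp) (fun _ _ _ => by simp)
  have := sum_inverseGram_change b c B f
  simp only [CovTensor.contract, sum_apply, smul_apply, smul_eq_mul]
  exact this

/-- The isometry carries `c` to a basis of `V` with the same Gram matrix, so the claim reduces to
basis independence. -/
theorem contract_pullback (b : Module.Basis (Fin n) ℝ V) (c : Module.Basis (Fin n) ℝ W)
    {B : V →L[ℝ] V →L[ℝ] ℝ} {B' : W →L[ℝ] W →L[ℝ] ℝ} {E : W ≃L[ℝ] V}
    (hE : ∀ v w, B (E v) (E w) = B' v w) (T : CovTensor (k + 2) V) (v : Fin k → W) :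
    CovTensor.contract c B'
      (T.compLinearMap fun _ => (E : W →ₗ[ℝ] V)) v = T.contract b B (fun i => E (v i)) := by
  rw [contract_change (c.map E.toLinearEquiv) b B T]
  simp only [CovTensor.contract, inverseGram_pullback c hE, sum_apply,
    smul_apply, MultilinearMap.curryLeft_apply, MultilinearMap.compLinearMap_apply]
  refine Finset.sum_congr rfl fun i _ => Finset.sum_congr rfl fun j _ => ?_
  congr 2
  ext s
  refine Fin.cases ?_ (fun s => Fin.cases ?_ (fun s => ?_) s) s <;> simp

theorem hodgeDual_apply (h : p + q = n) (b : Module.Basis (Fin n) ℝ V) (B : V →L[ℝ] V →L[ℝ] ℝ)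
    (ε : V [⋀^Fin n]→L[ℝ] ℝ) (F : V [⋀^Fin p]→L[ℝ] ℝ) (v : Fin q → V) :
    hodgeDual h b B ε F v = ((p.factorial : ℝ)⁻¹) * ∑ i : Fin p → Fin n, ∑ j : Fin p → Fin n,
      ((∏ s, inverseGram b B (i s) (j s)) * F (fun s => b (j s))) *
        ε (fun t => Fin.append (fun s => b (i s)) v (Fin.cast h.symm t)) := by
  simp only [hodgeDual, ContinuousAlternatingMap.smul_apply, ContinuousAlternatingMap.sum_apply,
    smul_eq_mul]
  rfl

theorem hodgeDual_change (h : p + q = n) (b c : Module.Basis (Fin n) ℝ V)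
    (B : V →L[ℝ] V →L[ℝ] ℝ) (ε : V [⋀^Fin n]→L[ℝ] ℝ) (F : V [⋀^Fin p]→L[ℝ] ℝ) :
    hodgeDual h c B ε F = hodgeDual h b B ε F := by
  ext v
  rw [hodgeDual_apply, hodgeDual_apply]
  congr 1
  let e : MultilinearMap ℝ (fun _ : Fin p => V) (MultilinearMap ℝ (fun _ : Fin q => V) ℝ) :=
    MultilinearMap.currySum (ε.toMultilinearMap.domDomCongr
      ((finCongr h.symm).trans finSumFinEquiv.symm))
  have he : ∀ a, e a v = ε (fun t => Fin.append a v (Fin.cast h.symm t)) := by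
    intro a
    simp only [e, MultilinearMap.currySum_apply, MultilinearMap.domDomCongr_apply]
    subst h
    refine congrArg ε (funext fun t => ?_)
    refine Fin.addCases (fun t => ?_) (fun t => ?_) t <;> simp
  let apply_v : MultilinearMap ℝ (fun _ : Fin q => V) ℝ →ₗ[ℝ] ℝ :=
    { toFun g := g v, map_add' _ _ := rfl, map_smul' _ _ := rfl }
  -- The Hodge sum at `v` is the metric contraction of the pairing `(a, a') ↦ ε (a, v) * F a'`, so
  -- the basis change for `p` pairs of slots applies.
  let f : MultilinearMap ℝ (fun _ : Fin p => V) (MultilinearMap ℝ (fun _ : Fin p => V) ℝ) :=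
    LinearMap.compMultilinearMap
      ((LinearMap.toSpanSingleton ℝ _ F.toMultilinearMap).comp
        apply_v) e
  have hf : ∀ a a', f a a' = ε (fun t => Fin.append a v (Fin.cast h.symm t)) * F a' := by
    intro a a'
    rw [← he]
    rfl
  have := sum_prod_inverseGram_change b c B f
  simp only [hf] at this
  simpa only [mul_assoc, mul_comm, mul_left_comm] using this

theorem hodgeDual_pullback (h : p + q = n) (b : Module.Basis (Fin n) ℝ V)
    (c : Module.Basis (Fin n) ℝ W) {B : V →L[ℝ] V →L[ℝ] ℝ} {B' : W →L[ℝ] W →L[ℝ] ℝ}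
    {E : W ≃L[ℝ] V} (hE : ∀ v w, B (E v) (E w) = B' v w) (ε : V [⋀^Fin n]→L[ℝ] ℝ)
    (F : V [⋀^Fin p]→L[ℝ] ℝ) :
    hodgeDual h c B'
      (ε.compContinuousLinearMap (E : W →L[ℝ] V)) (F.compContinuousLinearMap (E : W →L[ℝ] V)) =
      (hodgeDual h b B ε F).compContinuousLinearMap (E : W →L[ℝ] V) := by
  rw [hodgeDual_change h (c.map E.toLinearEquiv) b B ε F]
  ext v
  simp only [ContinuousAlternatingMap.compContinuousLinearMap_apply, hodgeDual_apply,
    inverseGram_pullback c hE]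
  subst h
  congr 1
  refine Finset.sum_congr rfl fun i _ => Finset.sum_congr rfl fun j _ => ?_
  congr 2
  ext t
  refine Fin.addCases (fun t => ?_) (fun t => ?_) t <;> simp

end Naturality

/-! ### Minkowski space, null bases and boosts. -/

section Minkowski

variable {n p q k : ℕ}

/-- The isometries of a scalar product. -/
def IsIsometryOf {V : Type*} [AddCommGroup V] [Module ℝ V] [TopologicalSpace V]
    (B : V →L[ℝ] V →L[ℝ] ℝ) (A : V ≃L[ℝ] V) : Prop :=
  ∀ v w, B (A v) (A w) = B v w

/-- The Minkowski scalar product on `ℝⁿ` with time coordinate `t`. -/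
def minkowski (t : Fin n) : ModelSpace n →L[ℝ] ModelSpace n →L[ℝ] ℝ :=
  ∑ i, (if i = t then -1 else 1 : ℝ) •
    (EuclideanSpace.proj i : ModelSpace n →L[ℝ] ℝ).smulRight
      (EuclideanSpace.proj i : ModelSpace n →L[ℝ] ℝ)

theorem minkowski_eq_sum (t : Fin n) (v w : ModelSpace n) :
    minkowski t v w = ∑ i, (if i = t then -1 else 1 : ℝ) * (v i * w i) := by
  simp only [minkowski, sum_apply, smul_apply, ContinuousLinearMap.smulRight_apply, smul_eq_mul]
  rfl

/-- Expressing the product through the Euclidean one gives access to Euclidean orthonormal bases: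
those containing the time axis are Lorentz-orthonormal as well. -/
theorem minkowski_apply (t : Fin n) (v w : ModelSpace n) :
    minkowski t v w = inner ℝ v w - 2 * (v t * w t) := by
  have h : ∀ i, (if i = t then -1 else 1 : ℝ) * (v i * w i) =
      v i * w i - if i = t then 2 * (v t * w t) else 0 := by
    intro i
    split_ifs with hi
    · subst hi; ring
    · ring
  rw [minkowski_eq_sum]
  simp only [h, Finset.sum_sub_distrib]
  simp [PiLp.inner_apply, mul_comm]

/-- The entries of the Gram matrix of an orthonormal basis of a Lorentzian scalar product. -/
def lorentzGram (t i j : Fin n) : ℝ := if i = j then (if i = t then -1 else 1) else 0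

/-- The standard basis of `ℝⁿ`. -/
def stdBasis (n : ℕ) : Module.Basis (Fin n) ℝ (ModelSpace n) :=
  (EuclideanSpace.basisFun (Fin n) ℝ).toBasis

theorem orthonormalBasis_minkowski (t : Fin n) (b : OrthonormalBasis (Fin n) ℝ (ModelSpace n))
    (hb : b t = EuclideanSpace.single t 1) (i j : Fin n) :
    minkowski t (b i) (b j) = lorentzGram t i j := by
  have h : ∀ i, b i t = if i = t then 1 else 0 := by
    intro i
    have h1 : b i t = inner ℝ (b i) (b t) := by simp [hb, EuclideanSpace.inner_single_right]
    rw [h1, orthonormal_iff_ite.mp b.orthonormal]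
  rw [minkowski_apply, orthonormal_iff_ite.mp b.orthonormal, h, h, lorentzGram]
  by_cases hij : i = j
  · subst hij
    by_cases hit : i = t <;> simp [hit]; norm_num
  · by_cases hit : i = t
    · subst hit; simp [hij, Ne.symm hij]
    · simp [hij, hit]

theorem stdBasis_minkowski (t i j : Fin n) :
    minkowski t (stdBasis n i) (stdBasis n j) = lorentzGram t i j := by
  have := orthonormalBasis_minkowski t (EuclideanSpace.basisFun (Fin n) ℝ) (by simp) i j
  simpa [stdBasis] using this

theorem isIsometryOf_of_basis {V : Type*} [AddCommGroup V] [Module ℝ V] [TopologicalSpace V]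
    {B : V →L[ℝ] V →L[ℝ] ℝ} {W : Type*} [AddCommGroup W] [Module ℝ W] [TopologicalSpace W]
    {B' : W →L[ℝ] W →L[ℝ] ℝ} (f : Module.Basis (Fin n) ℝ V) {A : V →L[ℝ] W}
    (h : ∀ i j, B' (A (f i)) (A (f j)) = B (f i) (f j)) (v w : V) : B' (A v) (A w) = B v w := by
  have : LinearMap.mk₂ ℝ (fun v w => B' (A v) (A w)) (by simp) (by simp) (by simp) (by simp) =
      LinearMap.mk₂ ℝ (fun v w => B v w) (by simp) (by simp) (by simp) (by simp) :=
    LinearMap.ext_basis f f h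
  exact LinearMap.congr_fun₂ this v w

/-- The linear automorphism of `ℝⁿ` that multiplies the vectors of a basis by given factors. -/
def dilation (f : Module.Basis (Fin n) ℝ (ModelSpace n)) (w : Fin n → ℝˣ) :
    ModelSpace n ≃L[ℝ] ModelSpace n :=
  (f.equiv (f.unitsSMul w) (Equiv.refl _)).toContinuousLinearEquiv

@[simp]
theorem dilation_apply_basis (f : Module.Basis (Fin n) ℝ (ModelSpace n)) (w : Fin n → ℝˣ)
    (i : Fin n) : dilation f w (f i) = (w i : ℝ) • f i := by
  have : dilation f w (f i) = f.equiv (f.unitsSMul w) (Equiv.refl _) (f i) := rfl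
  rw [this, Module.Basis.equiv_apply, Module.Basis.unitsSMul_apply]
  rfl

theorem form_ext_basis {V : Type*} [AddCommGroup V] [Module ℝ V] [TopologicalSpace V]
    (f : Module.Basis (Fin n) ℝ V)
    {F G : V [⋀^Fin p]→L[ℝ] ℝ}
    (h : ∀ j : Fin p → Fin n, Function.Injective j → F (fun s => f (j s)) = G fun s => f (j s)) :
    F = G :=
  ContinuousAlternatingMap.toAlternatingMap_injective (f.ext_alternating h)

theorem form_apply_dilated (f : Module.Basis (Fin n) ℝ (ModelSpace n))
    {A : ModelSpace n ≃L[ℝ] ModelSpace n} {w : Fin n → ℝ} (hA : ∀ i, A (f i) = w i • f i)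
    (F : ModelSpace n [⋀^Fin p]→L[ℝ] ℝ) (j : Fin p → Fin n) :
    F (fun s => A (f (j s))) = (∏ s, w (j s)) * F fun s => f (j s) := by
  simp only [hA]
  exact F.toMultilinearMap.map_smul_univ (fun s => w (j s)) fun s => f (j s)

theorem volume_comp_dilated (f : Module.Basis (Fin n) ℝ (ModelSpace n))
    {A : ModelSpace n ≃L[ℝ] ModelSpace n} {w : Fin n → ℝ} (hA : ∀ i, A (f i) = w i • f i)
    (ε : ModelSpace n [⋀^Fin n]→L[ℝ] ℝ) :
    ε.compContinuousLinearMap (A : ModelSpace n →L[ℝ] ModelSpace n) = (∏ i, w i) • ε := by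
  refine form_ext_basis f fun j hj => ?_
  have hj' := Finite.injective_iff_bijective.mp hj
  simp only [ContinuousAlternatingMap.compContinuousLinearMap_apply,
    ContinuousAlternatingMap.smul_apply, smul_eq_mul]
  refine (form_apply_dilated f hA ε j).trans ?_
  rw [Function.Bijective.prod_comp hj' w]

/-- The basis obtained from `b` by replacing `b t` and `b r` by their sum and difference. -/
def nullVectors (b : Module.Basis (Fin n) ℝ (ModelSpace n)) (t r i : Fin n) : ModelSpace n :=
  if i = t then b t + b r else if i = r then b t - b r else b i

theorem span_nullVectors (b : Module.Basis (Fin n) ℝ (ModelSpace n)) {t r : Fin n} (h : r ≠ t) :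
    ⊤ ≤ Submodule.span ℝ (Set.range (nullVectors b t r)) := by
  rw [← b.span_eq, Submodule.span_le]
  have hm : ∀ i, nullVectors b t r i ∈ Submodule.span ℝ (Set.range (nullVectors b t r)) :=
    fun i => Submodule.subset_span ⟨i, rfl⟩
  have ht := hm t
  have hr := hm r
  simp only [nullVectors, if_true, if_neg h] at ht hr
  rintro _ ⟨i, rfl⟩
  rw [SetLike.mem_coe]
  by_cases hit : i = t
  · subst hit
    have := Submodule.smul_mem _ (2⁻¹ : ℝ) (Submodule.add_mem _ ht hr)
    have h2 : b i = (2⁻¹ : ℝ) • (b i + b r + (b i - b r)) := by module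
    rwa [← h2] at this
  by_cases hir : i = r
  · subst hir
    have := Submodule.smul_mem _ (2⁻¹ : ℝ) (Submodule.sub_mem _ ht hr)
    have h2 : b i = (2⁻¹ : ℝ) • (b t + b i - (b t - b i)) := by module
    rwa [← h2] at this
  · have := hm i
    simpa only [nullVectors, if_neg hit, if_neg hir] using this

/-- The null basis associated with an orthonormal basis. -/
def nullBasis (b : Module.Basis (Fin n) ℝ (ModelSpace n)) {t r : Fin n} (h : r ≠ t) :
    Module.Basis (Fin n) ℝ (ModelSpace n) :=
  basisOfTopLeSpanOfCardEqFinrank (nullVectors b t r) (span_nullVectors b h) (by simp)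

theorem nullBasis_apply (b : Module.Basis (Fin n) ℝ (ModelSpace n)) {t r : Fin n} (h : r ≠ t)
    (i : Fin n) :
    nullBasis b h i = if i = t then b t + b r else if i = r then b t - b r else b i := by
  simp [nullBasis, nullVectors]

theorem minkowski_nullBasis {b : Module.Basis (Fin n) ℝ (ModelSpace n)} {t r : Fin n} (h : r ≠ t)
    (hb : ∀ i j, minkowski t (b i) (b j) = lorentzGram t i j) (i j : Fin n) :
    minkowski t (nullBasis b h i) (nullBasis b h j) =
      if i = t then (if j = r then -2 else 0) else if i = r then (if j = t then -2 else 0)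
      else if i = j then 1 else 0 := by
  simp only [nullBasis_apply]
  split_ifs <;> simp_all [lorentzGram, Ne.symm] <;> norm_num

/-- The weights of the boost with factor `c` in the plane spanned by `b t` and `b r`. -/
def boostWeight (t r : Fin n) (c : ℝˣ) (i : Fin n) : ℝˣ :=
  if i = t then c⁻¹ else if i = r then c else 1

theorem boostWeight_coe (t r : Fin n) (c : ℝˣ) (i : Fin n) :
    (boostWeight t r c i : ℝ) = if i = t then (c : ℝ)⁻¹ else if i = r then (c : ℝ) else 1 := by
  unfold boostWeight
  split_ifs <;> simp

theorem isIsometryOf_boost {b : Module.Basis (Fin n) ℝ (ModelSpace n)} {t r : Fin n} (h : r ≠ t)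
    (hb : ∀ i j, minkowski t (b i) (b j) = lorentzGram t i j) (c : ℝˣ) :
    IsIsometryOf (minkowski t) (dilation (nullBasis b h) (boostWeight t r c)) := by
  refine isIsometryOf_of_basis
    (A := (dilation (nullBasis b h) (boostWeight t r c)).toContinuousLinearMap) (nullBasis b h)
    fun i j => ?_
  have hc : (c : ℝ) ≠ 0 := c.ne_zero
  simp only [ContinuousLinearEquiv.coe_coe, dilation_apply_basis, map_smul,
    smul_apply, smul_eq_mul, minkowski_nullBasis h hb, boostWeight_coe]
  by_cases hi : i = t <;> by_cases hi' : i = r <;> by_cases hj : j = t <;> by_cases hj' : j = r <;>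
    by_cases hij : i = j <;> simp_all

/-- By injectivity `t` and `r` occur at most once each among the indices, so only the exponents
`-1`, `0`, `1` of `c` can appear. This restriction to alternating components is what makes
form-valued operations affine on null forms. -/
theorem prod_boostWeight {t r : Fin n} (h : r ≠ t) (c : ℝˣ) (j : Fin q → Fin n)
    (hj : Function.Injective j) :
    ∏ s, (boostWeight t r c (j s) : ℝ) =
      (if t ∈ Set.range j then (c : ℝ)⁻¹ else 1) * (if r ∈ Set.range j then (c : ℝ) else 1) := by
  classical
  have h1 : ∀ (u : Fin n) (a : ℝ), ∏ s, (if j s = u then a else 1) =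
      if u ∈ Set.range j then a else 1 := by
    intro u a
    by_cases hu : u ∈ Set.range j
    · obtain ⟨s, rfl⟩ := hu
      simp [hj.eq_iff, Finset.prod_ite_eq']
    · rw [if_neg hu]
      refine Finset.prod_eq_one fun s _ => if_neg fun hs => hu ⟨s, hs⟩
  rw [← h1, ← h1, ← Finset.prod_mul_distrib]
  refine Finset.prod_congr rfl fun s _ => ?_
  rw [boostWeight_coe]
  by_cases hs : j s = t
  · simp [hs, Ne.symm h]
  · simp [hs]

theorem volume_comp_boost (b : Module.Basis (Fin n) ℝ (ModelSpace n)) {t r : Fin n} (h : r ≠ t)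
    (c : ℝˣ) (ε : ModelSpace n [⋀^Fin n]→L[ℝ] ℝ) :
    ε.compContinuousLinearMap
      (dilation (nullBasis b h) (boostWeight t r c) : ModelSpace n →L[ℝ] ModelSpace n) = ε := by
  rw [volume_comp_dilated (nullBasis b h) (fun i => dilation_apply_basis _ _ i),
    prod_boostWeight h c (fun i => i) Function.injective_id]
  simp

end Minkowski

/-! ### Null forms are rescaled by boosts. -/

section NullForms

variable {n p q k : ℕ}

/-- A null vector is proportional to the sum of a timelike and a spacelike vector of an
orthonormal basis. -/
theorem exists_adapted_basis (t : Fin n) {ℓ : ModelSpace n} (h0 : ℓ ≠ 0)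
    (hℓ : minkowski t ℓ ℓ = 0) :
    ∃ (r : Fin n) (_ : r ≠ t) (b : Module.Basis (Fin n) ℝ (ModelSpace n)) (a : ℝ), a ≠ 0 ∧
      (∀ i j, minkowski t (b i) (b j) = lorentzGram t i j) ∧ ℓ = a • (b t + b r) := by
  set a := ℓ t with ha
  set e : ModelSpace n := EuclideanSpace.single t 1 with he
  have hee : inner ℝ e e = (1 : ℝ) := by simp [he]
  have hle : inner ℝ ℓ e = a := by simp [he, EuclideanSpace.inner_single_right, ha]
  have hel : inner ℝ e ℓ = a := by rw [real_inner_comm, hle]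
  have hll : inner ℝ ℓ ℓ = 2 * (a * a) := by
    rw [minkowski_apply] at hℓ; linarith
  have ha0 : a ≠ 0 := by
    intro h
    rw [h, mul_zero, mul_zero, inner_self_eq_zero] at hll
    exact h0 hll
  -- After normalizing the time component of `ℓ` to `1`, `u` is the remaining spatial part. The null
  -- condition makes it a unit vector orthogonal to `e`.
  set u : ModelSpace n := a⁻¹ • ℓ - e with hu
  have hlu : ℓ = a • (e + u) := by
    rw [hu, add_sub_cancel, smul_inv_smul₀ ha0]
  have hue : inner ℝ u e = (0 : ℝ) := by
    rw [hu, inner_sub_left, inner_smul_left, hle, hee]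
    simp [ha0]
  have huu : inner ℝ u u = (1 : ℝ) := by
    simp only [hu, inner_sub_left, inner_sub_right, inner_smul_left, inner_smul_right, hle, hel,
      hee, hll, conj_trivial]
    field_simp
    norm_num
  have hut : u t = 0 := by
    rw [← hue]; simp [he, EuclideanSpace.inner_single_right]
  -- The only purpose of this choice is an index `r ≠ t`: `u` is nonzero but its `t`-coordinate
  -- vanishes.
  obtain ⟨r, hr⟩ : ∃ r, u r ≠ 0 := by
    by_contra! h
    have : u = 0 := by ext i; simpa using h i
    rw [this] at huu
    simp at huu
  have hrt : r ≠ t := by rintro rfl; exact hr hut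
  have hon : Orthonormal ℝ (({t, r} : Set (Fin n)).domRestrict
      (fun i => if i = t then e else u)) := by
    rw [orthonormal_iff_ite]
    rintro ⟨i, hi⟩ ⟨j, hj⟩
    have heu : inner ℝ e u = (0 : ℝ) := by rw [real_inner_comm, hue]
    have he1 : ‖e‖ = 1 := by simp [he]
    have hu1 : ‖u‖ = 1 := by
      rw [real_inner_self_eq_norm_sq] at huu
      exact by simpa using (pow_eq_one_iff_of_nonneg (norm_nonneg u) two_ne_zero).mp huu
    rcases hi with rfl | rfl <;> rcases hj with rfl | rfl <;>
      simp [hrt, Ne.symm hrt, he1, hu1, hue, heu, Set.domRestrict, Subtype.ext_iff]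
  obtain ⟨b, hb⟩ := hon.exists_orthonormalBasis_extension_of_card_eq (by simp)
  have hbt : b t = e := by simpa using hb t (by simp)
  have hbr : b r = u := by simpa [hrt] using hb r (by simp)
  refine ⟨r, hrt, b.toBasis, a, ha0, fun i j => ?_, ?_⟩
  · simpa using orthonormalBasis_minkowski t b hbt i j
  · simpa [hbt, hbr] using hlu

/-- In `ℓ ∧ F` evaluated on `(ℓ, v)`, all terms but the first insert `ℓ` into `F` and vanish, which
leaves `B ℓ ℓ * F v = 0`. -/
theorem IsNullAt.isotropic {V : Type*} [AddCommGroup V] [Module ℝ V] [TopologicalSpace V]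
    {B : V →L[ℝ] V →L[ℝ] ℝ} {F : V [⋀^Fin p]→L[ℝ] ℝ} (hF : F ≠ 0) {ℓ : V}
    (h1 : ∀ v : Fin p → V, (∃ i, v i = ℓ) → F v = 0)
    (h2 : ∀ v : Fin (p + 1) → V,
      ∑ i : Fin (p + 1), (-1 : ℝ) ^ (i : ℕ) * B ℓ (v i) * F (i.removeNth v) = 0) :
    B ℓ ℓ = 0 := by
  by_contra h
  refine hF (ContinuousAlternatingMap.ext fun v => ?_)
  have := h2 (Fin.cons ℓ v)
  rw [Fin.sum_univ_succ, Finset.sum_eq_zero, add_zero] at this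
  · simpa [h] using this
  · intro i _
    rw [h1, mul_zero]
    cases p with
    | zero => exact i.elim0
    | succ p => exact ⟨0, by simp [Fin.removeNth]⟩

/-- A null form is rescaled by the boosts in a suitable plane, and the components of tensors with
respect to a suitable basis are rescaled by these boosts. -/
theorem IsNullAt.exists_boosts {t : Fin n} {F : ModelSpace n [⋀^Fin p]→L[ℝ] ℝ}
    (hF : IsNullAt (minkowski t) F) :
    ∃ (f : Module.Basis (Fin n) ℝ (ModelSpace n)) (w : ℝ → Fin n → ℝ),
      (∀ c : ℝ, 0 < c → ∃ A : ModelSpace n ≃L[ℝ] ModelSpace n, IsIsometryOf (minkowski t) A ∧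
        (∀ i, A (f i) = w c i • f i) ∧
        (∀ ε : ModelSpace n [⋀^Fin n]→L[ℝ] ℝ,
          ε.compContinuousLinearMap (A : ModelSpace n →L[ℝ] ModelSpace n) = ε) ∧
        F.compContinuousLinearMap (A : ModelSpace n →L[ℝ] ModelSpace n) = c • F) ∧
      ∀ (q : ℕ) (j : Fin q → Fin n), Function.Injective j →
        (∀ c : ℝ, 0 < c → ∏ s, w c (j s) = 1) ∨ (∀ c : ℝ, 0 < c → ∏ s, w c (j s) = c) ∨
          (∀ c : ℝ, 0 < c → ∏ s, w c (j s) = c⁻¹) := by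
  by_cases hF0 : F = 0
  -- For `F = 0` the vector `ℓ` need not be isotropic. The identity serves as the isometry, since it
  -- maps `0` to `c • 0`.
  · refine ⟨stdBasis n, fun _ _ => 1, fun c hc => ⟨ContinuousLinearEquiv.refl ℝ _,
      fun _ _ => rfl, by simp, fun ε => by ext; simp, by ext; simp [hF0]⟩, by simp⟩
  obtain ⟨ℓ, hℓ0, h1, h2⟩ := hF
  obtain ⟨r, hr, b, a, ha, hb, hℓ⟩ := exists_adapted_basis t hℓ0 (IsNullAt.isotropic hF0 h1 h2)
  set f := nullBasis b hr with hf
  have hft : ℓ = a • f t := by rw [hℓ, hf, nullBasis_apply, if_pos rfl]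
  have ht : ∀ j : Fin p → Fin n, t ∈ Set.range j → F (fun s => f (j s)) = 0 := by
    rintro j ⟨s, hs⟩
    have := h1 (Function.update (fun s => f (j s)) s (a • f (j s))) ⟨s, by simp [hft, hs]⟩
    rw [F.map_update_smul] at this
    simpa [ha] using this
  -- Among the null basis vectors only `f r` has a nonzero product with `ℓ`, so evaluating `ℓ ∧ F`
  -- on `f r` and vectors with indices other than `r` isolates one component. Together with `ht`,
  -- every nonzero component contains `r` and omits `t`, hence has weight `c`.
  have hr' : ∀ j : Fin p → Fin n, r ∉ Set.range j → F (fun s => f (j s)) = 0 := by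
    intro j hj
    have := h2 (Fin.cons (f r) fun s => f (j s))
    rw [Fin.sum_univ_succ, Finset.sum_eq_zero, add_zero] at this
    · simpa [hft, ha, hf, minkowski_nullBasis hr hb] using this
    · intro i _
      have : j i ≠ r := fun h => hj ⟨i, h⟩
      simp [hft, hf, minkowski_nullBasis hr hb, this]
  -- The weight at `c = 0` is a junk value: all assertions concern `c > 0`.
  refine ⟨f, fun c => if h : c = 0 then 1 else fun i => boostWeight t r (Units.mk0 c h) i,
    fun c hc => ⟨dilation f (boostWeight t r (Units.mk0 c hc.ne')), isIsometryOf_boost hr hb _,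
      fun i => by simp [hc.ne'], volume_comp_boost b hr _, ?_⟩, fun q j hj => ?_⟩
  · refine form_ext_basis f fun j hj => ?_
    refine (form_apply_dilated f (fun i => dilation_apply_basis _ _ i) F j).trans ?_
    rw [prod_boostWeight hr _ j hj]
    simp only [ContinuousAlternatingMap.smul_apply, smul_eq_mul]
    by_cases htj : t ∈ Set.range j
    · simp [ht j htj]
    by_cases hrj : r ∈ Set.range j
    · simp only [if_neg htj, if_pos hrj, one_mul, Units.val_mk0]
    · simp [hr' j hrj]
  · have : ∀ c : ℝ, 0 < c →
        ∏ s, (if h : c = 0 then 1 else fun i => (boostWeight t r (Units.mk0 c h) i : ℝ)) (j s) =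
        (if t ∈ Set.range j then c⁻¹ else 1) * (if r ∈ Set.range j then c else 1) := by
      intro c hc
      simp only [hc.ne', dite_false]
      exact prod_boostWeight hr _ j hj
    by_cases htj : t ∈ Set.range j <;> by_cases hrj : r ∈ Set.range j
    · left; intro c hc; rw [this c hc]; simp [htj, hrj, hc.ne']
    · right; right; intro c hc; rw [this c hc, if_pos htj, if_neg hrj, mul_one]
    · right; left; intro c hc; rw [this c hc, if_neg htj, if_pos hrj, one_mul]
    · left; intro c hc; rw [this c hc, if_neg htj, if_neg hrj, one_mul]

end NullForms

/-! ### Schur's lemma for the Lorentz group acting on forms. -/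

section Schur

variable {n p q r : ℕ}

/-- A linear map from `p`-forms to `r`-forms that commutes with the isometries of `B`. -/
def IsEquivariant (B : ModelSpace n →L[ℝ] ModelSpace n →L[ℝ] ℝ)
    (L : (ModelSpace n [⋀^Fin p]→L[ℝ] ℝ) →ₗ[ℝ] (ModelSpace n [⋀^Fin r]→ₗ[ℝ] ℝ)) : Prop :=
  ∀ A : ModelSpace n ≃L[ℝ] ModelSpace n, IsIsometryOf B A → ∀ F v,
    L (F.compContinuousLinearMap (A : ModelSpace n →L[ℝ] ModelSpace n)) v = L F fun s => A (v s)

/-- The form whose value at `v` is the determinant of the coordinates of `v` selected by `j`. -/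
def coordForm (j : Fin p → Fin n) : ModelSpace n [⋀^Fin p]→L[ℝ] ℝ :=
  { Matrix.detRowAlternating.compLinearMap
      (LinearMap.pi fun s => (EuclideanSpace.proj (j s) : ModelSpace n →L[ℝ] ℝ).toLinearMap) with
    cont := by
      change Continuous fun v : Fin p → ModelSpace n => (Matrix.of fun s s' => v s (j s')).det
      refine Continuous.matrix_det (continuous_matrix fun s s' => ?_)
      exact (EuclideanSpace.proj (j s') : ModelSpace n →L[ℝ] ℝ).continuous.comp
        (continuous_apply s) }

theorem coordForm_apply (j : Fin p → Fin n) (v : Fin p → ModelSpace n) :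
    coordForm j v = (Matrix.of fun s s' => v s (j s')).det := rfl

theorem stdBasis_apply (i k : Fin n) : stdBasis n i k = if k = i then 1 else 0 := by
  simp [stdBasis]

theorem coordForm_stdBasis {j : Fin p → Fin n} (hj : Function.Injective j) :
    coordForm j (fun s => stdBasis n (j s)) = 1 := by
  rw [coordForm_apply]
  convert Matrix.det_one (n := Fin p) (R := ℝ)
  ext s s'
  simp [stdBasis_apply, hj.eq_iff, Matrix.one_apply, eq_comm]

/-- The reflection of one coordinate. -/
def coordReflection (m : Fin n) : ModelSpace n ≃L[ℝ] ModelSpace n :=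
  dilation (stdBasis n) fun i => if i = m then -1 else 1

theorem coordReflection_stdBasis (m i : Fin n) :
    coordReflection m (stdBasis n i) = (if i = m then -1 else 1 : ℝ) • stdBasis n i := by
  rw [coordReflection, dilation_apply_basis]
  split_ifs <;> simp

theorem isIsometryOf_coordReflection (t m : Fin n) :
    IsIsometryOf (minkowski t) (coordReflection m) := by
  refine isIsometryOf_of_basis (A := (coordReflection m).toContinuousLinearMap) (stdBasis n)
    fun i j => ?_
  simp only [ContinuousLinearEquiv.coe_coe, coordReflection_stdBasis, map_smul, smul_apply,
    smul_eq_mul, stdBasis_minkowski, lorentzGram]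
  by_cases hij : i = j
  · subst hij; split_ifs <;> simp
  · simp [hij]

theorem prod_reflection_sign (m : Fin n) {j : Fin r → Fin n} (hj : Function.Injective j) :
    ∏ s, (if j s = m then -1 else 1 : ℝ) = if m ∈ Set.range j then -1 else 1 := by
  by_cases hu : m ∈ Set.range j
  · obtain ⟨s, rfl⟩ := hu
    simp [hj.eq_iff, Finset.prod_ite_eq']
  · rw [if_neg hu]
    exact Finset.prod_eq_one fun s _ => if_neg fun hs => hu ⟨s, hs⟩

theorem form_apply_coordReflection (m : Fin n) (F : ModelSpace n [⋀^Fin r]→ₗ[ℝ] ℝ)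
    {j : Fin r → Fin n} (hj : Function.Injective j) :
    F (fun s => coordReflection m (stdBasis n (j s))) =
      (if m ∈ Set.range j then -1 else 1) * F fun s => stdBasis n (j s) := by
  simp only [coordReflection_stdBasis]
  rw [← prod_reflection_sign m hj]
  exact F.toMultilinearMap.map_smul_univ _ _

/-- Coordinate reflections separate the index sets. Averaging `F` over the reflection in `m`, with
the sign that it has on the component `j`, preserves the `j`-component of `L F` and kills all
components of `F` whose index sets disagree with that of `j` about `m`. After all `m` have been
treated, only components with the index set of `j` could remain, and these vanish by assumption. -/
theorem IsEquivariant.apply_eq_zero {t : Fin n}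
    {L : (ModelSpace n [⋀^Fin p]→L[ℝ] ℝ) →ₗ[ℝ] (ModelSpace n [⋀^Fin r]→ₗ[ℝ] ℝ)}
    (hL : IsEquivariant (minkowski t) L) {j : Fin r → Fin n} (hj : Function.Injective j)
    {F : ModelSpace n [⋀^Fin p]→L[ℝ] ℝ}
    (hF : ∀ i : Fin p → Fin n, Function.Injective i → Set.range i = Set.range j →
      F (fun s => stdBasis n (i s)) = 0) :
    L F (fun s => stdBasis n (j s)) = 0 := by
  have key : ∀ S : Finset (Fin n), ∃ G : ModelSpace n [⋀^Fin p]→L[ℝ] ℝ,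
      L G (fun s => stdBasis n (j s)) = L F (fun s => stdBasis n (j s)) ∧
      ∀ i : Fin p → Fin n, Function.Injective i →
        (F (fun s => stdBasis n (i s)) = 0 ∨ ∃ m ∈ S, ¬(m ∈ Set.range i ↔ m ∈ Set.range j)) →
        G (fun s => stdBasis n (i s)) = 0 := by
    intro S
    induction S using Finset.induction_on with
    | empty => exact ⟨F, rfl, by simp⟩
    | insert m S _ ih =>
      obtain ⟨G, hG, hG'⟩ := ih
      set a : ℝ := if m ∈ Set.range j then -1 else 1 with ha
      have ha2 : a * a = 1 := by rw [ha]; split_ifs <;> norm_num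
      refine ⟨(2⁻¹ : ℝ) • (G + a • G.compContinuousLinearMap
        (coordReflection m : ModelSpace n →L[ℝ] ModelSpace n)), ?_, fun i hi h => ?_⟩
      · have h1 : L (G.compContinuousLinearMap
            (coordReflection m : ModelSpace n →L[ℝ] ModelSpace n)) (fun s => stdBasis n (j s)) =
            a * L G (fun s => stdBasis n (j s)) := by
          rw [hL _ (isIsometryOf_coordReflection t m), form_apply_coordReflection m _ hj]
        simp only [map_smul, map_add, AlternatingMap.smul_apply, AlternatingMap.add_apply, h1,
          smul_eq_mul, ← mul_assoc, ha2]
        rw [← hG]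
        ring
      · have h1 : G.compContinuousLinearMap
            (coordReflection m : ModelSpace n →L[ℝ] ModelSpace n) (fun s => stdBasis n (i s)) =
            (if m ∈ Set.range i then -1 else 1) * G (fun s => stdBasis n (i s)) :=
          form_apply_coordReflection m G.toAlternatingMap hi
        simp only [ContinuousAlternatingMap.smul_apply, ContinuousAlternatingMap.add_apply, h1,
          smul_eq_mul]
        by_cases h0 : G (fun s => stdBasis n (i s)) = 0
        · simp [h0]
        have hm : ¬(m ∈ Set.range i ↔ m ∈ Set.range j) := by
          rcases h with h | ⟨m', hm', h⟩
          · exact absurd (hG' i hi (Or.inl h)) h0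
          · rcases Finset.mem_insert.mp hm' with rfl | hm'
            · exact h
            · exact absurd (hG' i hi (Or.inr ⟨m', hm', h⟩)) h0
        by_cases hmi : m ∈ Set.range i <;> by_cases hmj : m ∈ Set.range j <;>
          simp [ha, hmi, hmj] at hm ⊢
  obtain ⟨G, hG, hG'⟩ := key Finset.univ
  have : G = 0 := by
    refine form_ext_basis (stdBasis n) fun i hi => hG' i hi ?_
    by_cases h : Set.range i = Set.range j
    · exact Or.inl (hF i hi h)
    · right
      by_contra! h'
      exact h (Set.ext fun m => h' m (Finset.mem_univ m))
  rw [← hG, this, map_zero]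
  rfl

/-- There is no nonzero equivariant map between forms of different degrees. -/
theorem IsEquivariant.eq_zero {t : Fin n}
    {L : (ModelSpace n [⋀^Fin p]→L[ℝ] ℝ) →ₗ[ℝ] (ModelSpace n [⋀^Fin r]→ₗ[ℝ] ℝ)}
    (hL : IsEquivariant (minkowski t) L) (hpr : r ≠ p) : L = 0 := by
  refine LinearMap.ext fun F => (stdBasis n).ext_alternating fun j hj => ?_
  refine hL.apply_eq_zero hj fun i hi h => absurd ?_ hpr
  have h1 := Set.ncard_univ (Fin p)
  have h2 := Set.ncard_univ (Fin r)
  rw [← Set.ncard_image_of_injective _ hi, Set.image_univ, h, ← Set.image_univ,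
    Set.ncard_image_of_injective _ hj, h2] at h1
  simpa using h1

theorem exists_perm_of_range_eq {i j : Fin p → Fin n} (hi : Function.Injective i)
    (hj : Function.Injective j) (h : Set.range i = Set.range j) :
    ∃ σ : Equiv.Perm (Fin p), i = j ∘ σ := by
  refine ⟨(Equiv.ofInjective i hi).trans ((Equiv.setCongr h).trans
    (Equiv.ofInjective j hj).symm), funext fun s => ?_⟩
  simp [Equiv.apply_ofInjective_symm hj]

theorem sign_mul_self_real (σ : Equiv.Perm (Fin p)) :
    ((Equiv.Perm.sign σ : ℤ) : ℝ) * ((Equiv.Perm.sign σ : ℤ) : ℝ) = 1 := by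
  rw [← Int.cast_mul, ← Units.val_mul, Int.units_mul_self]; simp

theorem form_comp_perm {V : Type*} [AddCommGroup V] [Module ℝ V] (F : V [⋀^Fin p]→ₗ[ℝ] ℝ)
    (v : Fin p → V) (σ : Equiv.Perm (Fin p)) :
    F (fun s => v (σ s)) = ((Equiv.Perm.sign σ : ℤ) : ℝ) * F v := by
  have := F.map_perm v σ
  rw [Units.smul_def, zsmul_eq_mul] at this
  exact this

/-- The diagonal entries of an equivariant map. -/
def diagonalEntry
    (L : (ModelSpace n [⋀^Fin p]→L[ℝ] ℝ) →ₗ[ℝ] (ModelSpace n [⋀^Fin p]→ₗ[ℝ] ℝ))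
    (j : Fin p → Fin n) : ℝ :=
  L (coordForm j) fun s => stdBasis n (j s)

section Diagonal

variable {t : Fin n}
  {L : (ModelSpace n [⋀^Fin p]→L[ℝ] ℝ) →ₗ[ℝ] (ModelSpace n [⋀^Fin p]→ₗ[ℝ] ℝ)}

/-- Subtracting from `F` a multiple of `coordForm j` removes its `j`-component, and the difference
falls under `apply_eq_zero`. -/
theorem IsEquivariant.apply_eq_diagonalEntry (hL : IsEquivariant (minkowski t) L)
    {j : Fin p → Fin n} (hj : Function.Injective j) (F : ModelSpace n [⋀^Fin p]→L[ℝ] ℝ) :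
    L F (fun s => stdBasis n (j s)) = diagonalEntry L j * F fun s => stdBasis n (j s) := by
  set G := F - (F fun s => stdBasis n (j s)) • coordForm j with hG
  have h : L G (fun s => stdBasis n (j s)) = 0 := by
    refine hL.apply_eq_zero hj fun i hi h => ?_
    obtain ⟨σ, rfl⟩ := exists_perm_of_range_eq hi hj h
    refine (form_comp_perm G.toAlternatingMap (fun s => stdBasis n (j s)) σ).trans ?_
    have : G (fun s => stdBasis n (j s)) = 0 := by simp [hG, coordForm_stdBasis hj]
    exact mul_eq_zero_of_right _ this
  simp only [hG, map_sub, map_smul, AlternatingMap.sub_apply, AlternatingMap.smul_apply,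
    smul_eq_mul] at h
  rw [diagonalEntry]
  linarith

/-- Reordering the indices introduces the same sign in the form and in its arguments, so the signs
cancel. -/
theorem IsEquivariant.diagonalEntry_eq_of_range_eq (hL : IsEquivariant (minkowski t) L)
    {i j : Fin p → Fin n} (hi : Function.Injective i) (hj : Function.Injective j)
    (h : Set.range i = Set.range j) : diagonalEntry L i = diagonalEntry L j := by
  obtain ⟨σ, hσ⟩ := exists_perm_of_range_eq hi hj h
  have h1 := hL.apply_eq_diagonalEntry hj (coordForm i)
  have h2 : ∀ F : ModelSpace n [⋀^Fin p]→ₗ[ℝ] ℝ, (F fun s => stdBasis n (i s)) =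
      ((Equiv.Perm.sign σ : ℤ) : ℝ) * F fun s => stdBasis n (j s) := fun F => by
    rw [hσ]; exact form_comp_perm F (fun s => stdBasis n (j s)) σ
  have h3 : coordForm i (fun s => stdBasis n (i s)) = _ := h2 (coordForm i).toAlternatingMap
  rw [coordForm_stdBasis hi] at h3
  unfold diagonalEntry at h1 ⊢
  rw [h2, h1, mul_left_comm]
  exact (congrArg _ h3.symm).trans (mul_one _)

/-- These isometries connect diagonal entries whose index sets differ in one element. Only `s ≠ 0`
matters, so a boost is used when one of the two directions is the time axis and a transposition
otherwise. -/
theorem exists_isometry_mixing (t : Fin n) {x y : Fin n} (hxy : x ≠ y) :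
    ∃ (A : ModelSpace n ≃L[ℝ] ModelSpace n) (c s : ℝ), IsIsometryOf (minkowski t) A ∧ s ≠ 0 ∧
      A (stdBasis n x) = c • stdBasis n x + s • stdBasis n y ∧
      ∀ z, z ≠ x → z ≠ y → A (stdBasis n z) = stdBasis n z := by
  -- The boost with factor `2` halves `e_t + e_r` and doubles `e_t - e_r`. The entries `5/4` and
  -- `3/4` are the hyperbolic cosine and sine of `log 2`.
  have boost : ∀ {r : Fin n} (h : r ≠ t), ∃ A : ModelSpace n ≃L[ℝ] ModelSpace n,
      IsIsometryOf (minkowski t) A ∧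
      A (stdBasis n t) = (5 / 4 : ℝ) • stdBasis n t + (-(3 / 4) : ℝ) • stdBasis n r ∧
      A (stdBasis n r) = (5 / 4 : ℝ) • stdBasis n r + (-(3 / 4) : ℝ) • stdBasis n t ∧
      ∀ z, z ≠ t → z ≠ r → A (stdBasis n z) = stdBasis n z := by
    intro r h
    set f := nullBasis (stdBasis n) h with hf
    set A := dilation f (boostWeight t r (Units.mk0 2 two_ne_zero)) with hA
    have hft : f t = stdBasis n t + stdBasis n r := by simp [hf, nullBasis_apply]
    have hfr : f r = stdBasis n t - stdBasis n r := by simp [hf, nullBasis_apply, h]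
    have ht : A (f t) = (2⁻¹ : ℝ) • f t := by
      rw [hA, dilation_apply_basis, boostWeight_coe]; simp
    have hr : A (f r) = (2 : ℝ) • f r := by
      rw [hA, dilation_apply_basis, boostWeight_coe]; simp [h]
    rw [hft, map_add] at ht
    rw [hfr, map_sub] at hr
    refine ⟨A, isIsometryOf_boost h (stdBasis_minkowski t) _, ?_, ?_, fun z hzt hzr => ?_⟩
    · have : A (stdBasis n t) = (2⁻¹ : ℝ) • ((A (stdBasis n t) + A (stdBasis n r)) +
        (A (stdBasis n t) - A (stdBasis n r))) := by module
      rw [this, ht, hr]; module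
    · have : A (stdBasis n r) = (2⁻¹ : ℝ) • ((A (stdBasis n t) + A (stdBasis n r)) -
        (A (stdBasis n t) - A (stdBasis n r))) := by module
      rw [this, ht, hr]; module
    · have hz : f z = stdBasis n z := by simp [hf, nullBasis_apply, hzt, hzr]
      rw [← hz, hA, dilation_apply_basis, boostWeight_coe]
      simp [hzt, hzr]
  by_cases hx : x = t
  · subst hx
    obtain ⟨A, hA, h1, _, h3⟩ := boost (Ne.symm hxy)
    exact ⟨A, _, _, hA, by norm_num, h1, h3⟩
  by_cases hy : y = t
  · subst hy
    obtain ⟨A, hA, _, h2, h3⟩ := boost hxy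
    exact ⟨A, _, _, hA, by norm_num, h2, fun z h h' => h3 z h' h⟩
  set A : ModelSpace n ≃L[ℝ] ModelSpace n :=
    ((stdBasis n).equiv (stdBasis n) (Equiv.swap x y)).toContinuousLinearEquiv
  have hA : ∀ z, A (stdBasis n z) = stdBasis n (Equiv.swap x y z) := fun z =>
    Module.Basis.equiv_apply _ _ _ _
  refine ⟨A, 0, 1, isIsometryOf_of_basis (A := A.toContinuousLinearMap) (stdBasis n)
    fun i j => ?_, one_ne_zero, by simp [hA], fun z hzx hzy => ?_⟩
  · simp only [ContinuousLinearEquiv.coe_coe, hA, stdBasis_minkowski, lorentzGram,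
      EmbeddingLike.apply_eq_iff_eq]
    have : ∀ i, Equiv.swap x y i = t ↔ i = t := fun i => by
      rw [← Equiv.eq_symm_apply, Equiv.symm_swap,
        Equiv.swap_apply_of_ne_of_ne (Ne.symm hx) (Ne.symm hy)]
    simp [this]
  · rw [hA, Equiv.swap_apply_of_ne_of_ne hzx hzy]

/-- Let `A` mix `x` into `y`, and let `i` be `j` with `x` replaced by `y`. Computing the
`j`-component of `L` on the pullback of `coordForm i` by `A` in two ways gives `s * (diagonalEntry L
i - diagonalEntry L j) = 0`. -/
theorem IsEquivariant.diagonalEntry_swap_of_mem (hL : IsEquivariant (minkowski t) L) {x y : Fin n}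
    {j : Fin p → Fin n} (hj : Function.Injective j) (hx : x ∈ Set.range j)
    (hy : y ∉ Set.range j) : diagonalEntry L (Equiv.swap x y ∘ j) = diagonalEntry L j := by
  obtain ⟨s₀, rfl⟩ := hx
  have hxy : j s₀ ≠ y := fun h => hy ⟨s₀, h⟩
  obtain ⟨A, c, s, hA, hs, hAx, hAz⟩ := exists_isometry_mixing t hxy
  set i := Equiv.swap (j s₀) y ∘ j with hi
  have hi' : Function.Injective i := (Equiv.injective _).comp hj
  have hij : (fun u => stdBasis n (i u)) =
      Function.update (fun u => stdBasis n (j u)) s₀ (stdBasis n y) := by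
    ext1 u
    by_cases hu : u = s₀
    · subst hu; simp [hi]
    · rw [Function.update_of_ne hu, hi, Function.comp_apply,
        Equiv.swap_apply_of_ne_of_ne (fun h => hu (hj h)) fun h => hy ⟨u, h⟩]
  have hAj : (fun u => A (stdBasis n (j u))) =
      Function.update (fun u => stdBasis n (j u)) s₀ (c • stdBasis n (j s₀) + s • stdBasis n y) := by
    ext1 u
    by_cases hu : u = s₀
    · subst hu; simp [hAx]
    · rw [Function.update_of_ne hu, hAz _ (fun h => hu (hj h)) fun h => hy ⟨u, h⟩]
  have hG : ∀ G : ModelSpace n [⋀^Fin p]→ₗ[ℝ] ℝ, G (fun u => A (stdBasis n (j u))) =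
      c * G (fun u => stdBasis n (j u)) + s * G fun u => stdBasis n (i u) := by
    intro G
    rw [hAj, G.map_update_add, G.map_update_smul, G.map_update_smul, hij]
    simp
  have h1 := hL.apply_eq_diagonalEntry hj ((coordForm i).compContinuousLinearMap
    (A : ModelSpace n →L[ℝ] ModelSpace n))
  rw [hL A hA, hG, hL.apply_eq_diagonalEntry hj, hL.apply_eq_diagonalEntry hi'] at h1
  have h2 : (coordForm i).compContinuousLinearMap (A : ModelSpace n →L[ℝ] ModelSpace n)
      (fun u => stdBasis n (j u)) = c * coordForm i (fun u => stdBasis n (j u)) +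
        s * coordForm i fun u => stdBasis n (i u) := hG (coordForm i).toAlternatingMap
  rw [h2, coordForm_stdBasis hi'] at h1
  have h3 : s * (diagonalEntry L i - diagonalEntry L j) = 0 := by linarith
  have h4 := (mul_eq_zero.mp h3).resolve_left hs
  linarith

theorem IsEquivariant.diagonalEntry_swap (hL : IsEquivariant (minkowski t) L) (x y : Fin n)
    {j : Fin p → Fin n} (hj : Function.Injective j) :
    diagonalEntry L (Equiv.swap x y ∘ j) = diagonalEntry L j := by
  by_cases hx : x ∈ Set.range j <;> by_cases hy : y ∈ Set.range j
  · refine hL.diagonalEntry_eq_of_range_eq ((Equiv.injective _).comp hj) hj ?_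
    rw [Set.range_comp]
    ext z
    rw [Equiv.image_eq_preimage_symm, Equiv.symm_swap, Set.mem_preimage]
    rcases eq_or_ne z x with rfl | hzx
    · simp [hy, hx]
    rcases eq_or_ne z y with rfl | hzy
    · simp [hx, hy]
    · rw [Equiv.swap_apply_of_ne_of_ne hzx hzy]
  · exact hL.diagonalEntry_swap_of_mem hj hx hy
  · rw [Equiv.swap_comm]
    exact hL.diagonalEntry_swap_of_mem hj hy hx
  · congr 1
    ext1 s
    exact Equiv.swap_apply_of_ne_of_ne (fun h => hx ⟨s, h⟩) fun h => hy ⟨s, h⟩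

/-- **Schur's lemma** for forms on Minkowski space. -/
theorem IsEquivariant.exists_eq_smul (hL : IsEquivariant (minkowski t) L) :
    ∃ a : ℝ, ∀ F : ModelSpace n [⋀^Fin p]→L[ℝ] ℝ, L F = a • F.toAlternatingMap := by
  by_cases h : ∃ j : Fin p → Fin n, Function.Injective j
  · obtain ⟨j, hj⟩ := h
    refine ⟨diagonalEntry L j, fun F => (stdBasis n).ext_alternating fun i hi => ?_⟩
    have hperm : ∀ σ : Equiv.Perm (Fin n), diagonalEntry L (σ ∘ j) = diagonalEntry L j := by
      intro σ
      induction σ using Equiv.Perm.swap_induction_on with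
      | one => rfl
      | swap_mul σ x y _ ih =>
        rw [← ih]
        exact hL.diagonalEntry_swap x y ((Equiv.injective σ).comp hj)
    classical
    let e : {x // x ∈ Set.range j} ≃ {x // x ∈ Set.range i} :=
      (Equiv.ofInjective j hj).symm.trans (Equiv.ofInjective i hi)
    have hij : i = e.extendSubtype ∘ j := by
      ext1 s
      rw [Function.comp_apply, Equiv.extendSubtype_apply_of_mem _ _ ⟨s, rfl⟩]
      simp [e, Equiv.ofInjective_symm_apply hj]
    rw [hL.apply_eq_diagonalEntry hi, hij, hperm]
    rfl
  · refine ⟨0, fun F => (stdBasis n).ext_alternating fun i hi => absurd ⟨i, hi⟩ h⟩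

end Diagonal

end Schur

/-! ### The Hodge dual on Minkowski space and twisted equivariance. -/

section Hodge

variable {n p q r : ℕ}

/-- The Euclidean volume form of `ℝⁿ`. -/
def stdVol (n : ℕ) : ModelSpace n [⋀^Fin n]→L[ℝ] ℝ := coordForm id

theorem stdVol_stdBasis : stdVol n (stdBasis n) = 1 :=
  coordForm_stdBasis Function.injective_id

theorem volume_eq_smul (ε : ModelSpace n [⋀^Fin n]→L[ℝ] ℝ) :
    ε = ε (stdBasis n) • stdVol n := by
  refine form_ext_basis (stdBasis n) fun j hj => ?_
  obtain ⟨σ, rfl⟩ := exists_perm_of_range_eq hj Function.injective_id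
    ((Finite.injective_iff_surjective.mp hj).range_eq.trans Set.range_id.symm)
  refine (form_comp_perm ε.toAlternatingMap (stdBasis n) σ).trans ?_
  have : stdVol n (fun s => stdBasis n (σ s)) = _ :=
    form_comp_perm (stdVol n).toAlternatingMap (stdBasis n) σ
  have h1 : (stdVol n).toAlternatingMap (stdBasis n) = 1 := stdVol_stdBasis
  rw [h1, mul_one] at this
  refine (mul_comm _ _).trans ?_
  exact congrArg (ε (stdBasis n) * ·) this.symm

theorem abs_det_lorentzGram (t : Fin n) :
    |(Matrix.of fun i j => lorentzGram t i j).det| = 1 := by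
  have : (Matrix.of fun i j => lorentzGram t i j) =
      Matrix.diagonal fun i => if i = t then -1 else 1 := by
    ext i j
    simp [lorentzGram, Matrix.diagonal_apply]
  rw [this, Matrix.det_diagonal, Finset.abs_prod]
  exact Finset.prod_eq_one fun i _ => by split_ifs <;> simp

/-- Taking determinants in `N * D * Nᵀ = D` gives `(det N)² = 1`. -/
theorem stdVol_sq (t : Fin n) {v : Fin n → ModelSpace n}
    (hv : ∀ i j, minkowski t (v i) (v j) = lorentzGram t i j) : stdVol n v ^ 2 = 1 := by
  set N : Matrix (Fin n) (Fin n) ℝ := Matrix.of fun s s' => v s s' with hN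
  set D : Matrix (Fin n) (Fin n) ℝ := Matrix.of fun i j => lorentzGram t i j with hD
  have h : N * D * N.transpose = D := by
    have hD' : D = Matrix.diagonal fun i => if i = t then -1 else 1 := by
      ext i j
      simp [hD, lorentzGram, Matrix.diagonal_apply]
    ext i j
    rw [show D i j = lorentzGram t i j from rfl, ← hv i j, minkowski_eq_sum, hD']
    rw [Matrix.mul_apply]
    simp only [Matrix.mul_diagonal, Matrix.transpose_apply]
    exact Finset.sum_congr rfl fun k _ => by rw [hN, Matrix.of_apply, Matrix.of_apply]; ring
  have h1 := congrArg Matrix.det h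
  rw [Matrix.det_mul, Matrix.det_mul, Matrix.det_transpose] at h1
  have h2 : D.det ≠ 0 := fun h0 => by
    have := abs_det_lorentzGram t
    rw [← hD, h0] at this
    simp at this
  have h3 : stdVol n v = N.det := rfl
  rw [h3]
  have : D.det * (N.det ^ 2 - 1) = 0 := by linear_combination h1
  have := (mul_eq_zero.mp this).resolve_left h2
  linarith

theorem eq_or_eq_neg_stdVol {ε : ModelSpace n [⋀^Fin n]→L[ℝ] ℝ} (h : ε (stdBasis n) ^ 2 = 1) :
    ε = stdVol n ∨ ε = -stdVol n := by
  rcases mul_self_eq_one_iff.mp ((sq _).symm.trans h) with h | h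
  · left; rw [volume_eq_smul ε, h, one_smul]
  · right; rw [volume_eq_smul ε, h]; ext v; simp

/-- The sign of the determinant of an isometry. -/
theorem exists_stdVol_comp_isometry {t : Fin n} {A : ModelSpace n ≃L[ℝ] ModelSpace n}
    (hA : IsIsometryOf (minkowski t) A) : ∃ σ : ℝ, σ * σ = 1 ∧
      (stdVol n).compContinuousLinearMap (A : ModelSpace n →L[ℝ] ModelSpace n) =
        σ • stdVol n := by
  refine ⟨(stdVol n).compContinuousLinearMap (A : ModelSpace n →L[ℝ] ModelSpace n) (stdBasis n),
    ?_, volume_eq_smul _⟩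
  rw [← sq]
  refine stdVol_sq t (v := fun i => A (stdBasis n i)) fun i j => ?_
  rw [hA, stdBasis_minkowski]

theorem inverseGram_stdBasis (t : Fin n) :
    inverseGram (stdBasis n) (minkowski t) = Matrix.diagonal fun i => if i = t then -1 else 1 := by
  refine Matrix.inv_eq_right_inv ?_
  ext i j
  rw [Matrix.mul_diagonal]
  simp only [Matrix.of_apply, stdBasis_minkowski, lorentzGram, Matrix.one_apply]
  by_cases hij : i = j
  · subst hij; split_ifs <;> simp
  · simp [hij]

variable (h : p + q = n)

/-- The Hodge dual on Minkowski space, as a linear map. -/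
def hodgeLinear (t : Fin n) (ε : ModelSpace n [⋀^Fin n]→L[ℝ] ℝ) :
    (ModelSpace n [⋀^Fin p]→L[ℝ] ℝ) →ₗ[ℝ] (ModelSpace n [⋀^Fin q]→L[ℝ] ℝ) where
  toFun := hodgeDual h (stdBasis n) (minkowski t) ε
  map_add' F G := by
    ext v
    simp only [hodgeDual_apply, ContinuousAlternatingMap.add_apply, mul_add, add_mul,
      Finset.sum_add_distrib]
  map_smul' c F := by
    ext v
    simp only [hodgeDual_apply, ContinuousAlternatingMap.smul_apply, smul_eq_mul, RingHom.id_apply,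
      Finset.mul_sum]
    exact Finset.sum_congr rfl fun i _ => Finset.sum_congr rfl fun j _ => by ring

theorem hodgeLinear_smul_volume (t : Fin n) (c : ℝ) (ε : ModelSpace n [⋀^Fin n]→L[ℝ] ℝ)
    (F : ModelSpace n [⋀^Fin p]→L[ℝ] ℝ) :
    hodgeLinear h t (c • ε) F = c • hodgeLinear h t ε F := by
  ext v
  change hodgeDual _ _ _ _ _ _ = c * hodgeDual _ _ _ _ _ _
  simp only [hodgeDual_apply, ContinuousAlternatingMap.smul_apply, smul_eq_mul, Finset.mul_sum]
  exact Finset.sum_congr rfl fun i _ => Finset.sum_congr rfl fun j _ => by ring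

/-- Naturality moves the volume form along with `F`. The dual is linear in the volume form, so
restoring `stdVol` costs the factor `σ`. -/
theorem hodgeLinear_comp_isometry {t : Fin n} {A : ModelSpace n ≃L[ℝ] ModelSpace n}
    (hA : IsIsometryOf (minkowski t) A) {σ : ℝ} (hσ : σ * σ = 1)
    (hAσ : (stdVol n).compContinuousLinearMap (A : ModelSpace n →L[ℝ] ModelSpace n) =
        σ • stdVol n) (F : ModelSpace n [⋀^Fin p]→L[ℝ] ℝ) :
    hodgeLinear h t (stdVol n)
        (F.compContinuousLinearMap (A : ModelSpace n →L[ℝ] ModelSpace n)) =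
      σ • (hodgeLinear h t (stdVol n) F).compContinuousLinearMap
        (A : ModelSpace n →L[ℝ] ModelSpace n) := by
  have h1 := hodgeDual_pullback h (stdBasis n) (stdBasis n) hA (stdVol n) F
  rw [hAσ] at h1
  have h2 := hodgeLinear_smul_volume h t σ (stdVol n)
    (F.compContinuousLinearMap (A : ModelSpace n →L[ℝ] ModelSpace n))
  have h3 : σ • hodgeLinear h t (stdVol n)
      (F.compContinuousLinearMap (A : ModelSpace n →L[ℝ] ModelSpace n)) =
      (hodgeLinear h t (stdVol n) F).compContinuousLinearMap
        (A : ModelSpace n →L[ℝ] ModelSpace n) := h2.symm.trans h1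
  rw [← h3, smul_smul, hσ, one_smul]

theorem volume_append_perm {V : Type*} [AddCommGroup V] [Module ℝ V]
    (ε : V [⋀^Fin (p + q)]→ₗ[ℝ] ℝ) (a : Fin p → V) (v : Fin q → V) (σ : Equiv.Perm (Fin p)) :
    ε (Fin.append (fun s => a (σ s)) v) =
      ((Equiv.Perm.sign σ : ℤ) : ℝ) * ε (Fin.append a v) := by
  set τ : Equiv.Perm (Fin (p + q)) := finSumFinEquiv.permCongr (Equiv.sumCongr σ 1) with hτ
  have h1 : Fin.append (fun s => a (σ s)) v = fun s => Fin.append a v (τ s) := by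
    ext1 s
    refine Fin.addCases (fun s => ?_) (fun s => ?_) s <;>
      simp [hτ, Equiv.permCongr_apply]
  have h2 : Equiv.Perm.sign τ = Equiv.Perm.sign σ := by
    rw [hτ, Equiv.Perm.sign_permCongr]
    exact (Equiv.Perm.sign_sumCongr σ 1).trans (by simp)
  rw [h1, form_comp_perm, h2]

/-- The component of `F` at `i₀` is read off from `*F` on the complementary basis vectors. A term of
the contraction survives only if its indices are a permutation of `i₀`, and then it equals the term
of `i₀`, because the sign enters both through `F` and through the volume form. -/
theorem hodgeLinear_injective (t : Fin n) (F : ModelSpace n [⋀^Fin p]→L[ℝ] ℝ)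
    (hF : hodgeLinear h t (stdVol n) F = 0) : F = 0 := by
  subst h
  refine form_ext_basis (stdBasis _) fun i₀ hi₀ => ?_
  have hcard : Fintype.card {x // x ∉ Set.range i₀} = q := by
    classical
    rw [Fintype.card_subtype_compl,
      ← Fintype.card_congr (Equiv.ofInjective i₀ hi₀)]
    simp
  let e := (Fintype.equivFinOfCardEq hcard).symm
  let c : Fin q → Fin (p + q) := fun s => (e s : Fin (p + q))
  have hc : Function.Injective c := Subtype.val_injective.comp e.injective
  have hc' : ∀ x, x ∉ Set.range c → x ∈ Set.range i₀ := by
    intro x hx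
    by_contra h
    exact hx ⟨e.symm ⟨x, h⟩, by simp [c]⟩
  set sg : Fin (p + q) → ℝ := fun i => if i = t then -1 else 1 with hsg
  set term : (Fin p → Fin (p + q)) → ℝ := fun i =>
    (∏ s, sg (i s)) * F (fun s => stdBasis _ (i s)) *
      stdVol (p + q) (Fin.append (fun s => stdBasis _ (i s)) fun s => stdBasis _ (c s)) with hterm
  have happ : ∀ i : Fin p → Fin (p + q),
      Fin.append (fun s => stdBasis (p + q) (i s)) (fun s => stdBasis (p + q) (c s)) =
      fun s => stdBasis (p + q) (Fin.append i c s) := by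
    intro i
    ext1 s
    refine Fin.addCases (fun s => ?_) (fun s => ?_) s <;> simp
  have hsum : ∑ i, term i = 0 := by
    have h1 : hodgeDual rfl (stdBasis (p + q)) (minkowski t) (stdVol (p + q)) F
        (fun s => stdBasis (p + q) (c s)) = 0 := congrArg
        (fun G : ModelSpace (p + q) [⋀^Fin q]→L[ℝ] ℝ => G fun s => stdBasis (p + q) (c s)) hF
    rw [hodgeDual_apply, mul_eq_zero] at h1
    have h2 := h1.resolve_left (by positivity)
    rw [← h2]
    refine Finset.sum_congr rfl fun i _ => ?_
    rw [Finset.sum_eq_single i]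
    · simp only [inverseGram_stdBasis, Matrix.diagonal_apply_eq]
      rfl
    · intro j _ hji
      obtain ⟨s, hs⟩ : ∃ s, i s ≠ j s := by
        by_contra! h
        exact hji (funext fun s => (h s).symm)
      have h3 : inverseGram (stdBasis (p + q)) (minkowski t) (i s) (j s) = 0 := by
        rw [inverseGram_stdBasis]
        exact Matrix.diagonal_apply_ne _ hs
      rw [Finset.prod_eq_zero (Finset.mem_univ s) h3, zero_mul, zero_mul]
    · simp
  have hcases : ∀ i, term i = 0 ∨ term i = term i₀ := by
    intro i
    by_cases hinj : Function.Injective (Fin.append i c)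
    · right
      have hi : Function.Injective i := fun s s' hs => by
        have := @hinj (Fin.castAdd q s) (Fin.castAdd q s') (by simpa using hs)
        simpa using this
      have hsub : Set.range i ⊆ Set.range i₀ := by
        rintro _ ⟨s, rfl⟩
        refine hc' _ ?_
        rintro ⟨s', hs'⟩
        have := @hinj (Fin.natAdd p s') (Fin.castAdd q s) (by simpa using hs')
        have := congrArg Fin.val this
        simp at this
        omega
      have hr : Set.range i = Set.range i₀ := by
        refine Set.eq_of_subset_of_ncard_le hsub ?_ (Set.toFinite _)
        rw [← Set.image_univ, ← Set.image_univ, Set.ncard_image_of_injective _ hi,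
          Set.ncard_image_of_injective _ hi₀]
      obtain ⟨σ, rfl⟩ := exists_perm_of_range_eq hi hi₀ hr
      have h1 : F (fun s => stdBasis (p + q) (i₀ (σ s))) = _ :=
        form_comp_perm F.toAlternatingMap (fun s => stdBasis (p + q) (i₀ s)) σ
      have h2 : stdVol (p + q) (Fin.append (fun s => stdBasis _ (i₀ (σ s)))
          fun s => stdBasis _ (c s)) = _ :=
        volume_append_perm (stdVol (p + q)).toAlternatingMap (fun s => stdBasis _ (i₀ s))
          (fun s => stdBasis _ (c s)) σ
      simp only [hterm, Function.comp_apply]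
      rw [h1, h2, Equiv.prod_comp σ fun s => sg (i₀ s)]
      have h3 := sign_mul_self_real σ
      change (∏ s, sg (i₀ s)) * (_ * F _) * (_ * stdVol (p + q) _) = _
      linear_combination ((∏ s, sg (i₀ s)) * F (fun s => stdBasis _ (i₀ s)) *
        stdVol (p + q) (Fin.append (fun s => stdBasis _ (i₀ s)) fun s => stdBasis _ (c s))) * h3
    · left
      simp only [hterm, happ]
      have : stdVol (p + q) (fun s => stdBasis (p + q) (Fin.append i c s)) = 0 := by
        rw [Function.not_injective_iff] at hinj
        obtain ⟨s, s', hs, hne⟩ := hinj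
        exact (stdVol (p + q)).map_eq_zero_of_eq _ (by rw [hs]) hne
      rw [this, mul_zero]
  -- Multiplication by `term i₀` makes all summands nonnegative, so the vanishing sum forces `term
  -- i₀ = 0` without a count of the permutations.
  have h0 : term i₀ = 0 := by
    have h1 : term i₀ * term i₀ ≤ ∑ i, term i₀ * term i :=
      Finset.single_le_sum (f := fun i => term i₀ * term i) (fun i _ => by
        rcases hcases i with h | h <;> rw [h]
        · simp
        · exact mul_self_nonneg _) (Finset.mem_univ i₀)
    rw [← Finset.mul_sum, hsum, mul_zero] at h1
    exact mul_self_eq_zero.mp (le_antisymm h1 (mul_self_nonneg _))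
  have hsg0 : ∏ s, sg (i₀ s) ≠ 0 := Finset.prod_ne_zero_iff.mpr fun s _ => by
    simp only [hsg]; split_ifs <;> norm_num
  have hinj : Function.Injective (Fin.append i₀ c) := by
    rw [Fin.append_injective_iff]
    refine ⟨hi₀, hc, fun s s' hs => (e s').2 ⟨s, hs⟩⟩
  have hv0 : stdVol (p + q) (Fin.append (fun s => stdBasis _ (i₀ s))
      fun s => stdBasis _ (c s)) ≠ 0 := by
    rw [happ]
    obtain ⟨σ, hσ⟩ := exists_perm_of_range_eq hinj Function.injective_id
      ((Finite.injective_iff_surjective.mp hinj).range_eq.trans Set.range_id.symm)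
    have h1 : stdVol (p + q) (fun s => stdBasis _ (σ s)) = _ :=
      form_comp_perm (stdVol (p + q)).toAlternatingMap (stdBasis _) σ
    have h2 : (stdVol (p + q)).toAlternatingMap (stdBasis (p + q)) = 1 := stdVol_stdBasis
    rw [h2] at h1
    rw [hσ]
    intro h3
    have h4 := sign_mul_self_real σ
    have h5 : ((Equiv.Perm.sign σ : ℤ) : ℝ) = 0 := by
      rw [← mul_one ((Equiv.Perm.sign σ : ℤ) : ℝ), ← h1]; exact h3
    rw [h5] at h4
    simp at h4
  simpa [hterm, hsg0, hv0] using h0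

/-- The inclusion of continuous alternating maps into alternating maps. -/
def toAlternatingLinear (p n : ℕ) :
    (ModelSpace n [⋀^Fin p]→L[ℝ] ℝ) →ₗ[ℝ] (ModelSpace n [⋀^Fin p]→ₗ[ℝ] ℝ) where
  toFun F := F.toAlternatingMap
  map_add' _ _ := rfl
  map_smul' _ _ := rfl

/-- The sign of an isometry enters twice and cancels, so the double dual is equivariant and Schur's
lemma makes it a scalar. Injectivity yields the nonvanishing, so the sign of `**` is never computed.
-/
theorem exists_hodgeLinear_hodgeLinear (t : Fin n) (h' : q + p = n) :
    ∃ c : ℝ, c ≠ 0 ∧ ∀ F : ModelSpace n [⋀^Fin p]→L[ℝ] ℝ,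
      hodgeLinear h' t (stdVol n) (hodgeLinear h t (stdVol n) F) = c • F := by
  set K := (hodgeLinear h' t (stdVol n)).comp (hodgeLinear h t (stdVol n)) with hK
  have hKe : IsEquivariant (minkowski t) ((toAlternatingLinear p n).comp K) := by
    intro A hA F v
    obtain ⟨σ, hσ, hAσ⟩ := exists_stdVol_comp_isometry hA
    change K _ v = K F _
    rw [hK, LinearMap.comp_apply, hodgeLinear_comp_isometry h hA hσ hAσ, map_smul,
      hodgeLinear_comp_isometry h' hA hσ hAσ, smul_smul, hσ, one_smul]
    rfl
  obtain ⟨c, hc⟩ := hKe.exists_eq_smul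
  have hc' : ∀ F, K F = c • F := fun F =>
    ContinuousAlternatingMap.toAlternatingMap_injective (hc F)
  by_cases hc0 : c = 0
  -- A zero scalar would force every `F` to vanish by injectivity, and then `1` serves as well.
  · refine ⟨1, one_ne_zero, fun F => ?_⟩
    have h0 : hodgeLinear h' t (stdVol n) (hodgeLinear h t (stdVol n) F) = 0 := by
      have := hc' F
      rwa [hc0, zero_smul] at this
    have hF := hodgeLinear_injective h t F (hodgeLinear_injective h' t _ h0)
    rw [h0, hF, smul_zero]
  · exact ⟨c, hc0, hc'⟩

/-- A linear map from `p`-forms to `r`-forms that commutes with the isometries of Minkowski space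
up to the sign of the determinant. -/
def IsTwistedEquivariant (t : Fin n)
    (L : (ModelSpace n [⋀^Fin p]→L[ℝ] ℝ) →ₗ[ℝ] (ModelSpace n [⋀^Fin r]→ₗ[ℝ] ℝ)) : Prop :=
  ∀ (A : ModelSpace n ≃L[ℝ] ModelSpace n) (σ : ℝ), IsIsometryOf (minkowski t) A → σ * σ = 1 →
    (stdVol n).compContinuousLinearMap (A : ModelSpace n →L[ℝ] ModelSpace n) = σ • stdVol n →
    ∀ F v, L (F.compContinuousLinearMap (A : ModelSpace n →L[ℝ] ModelSpace n)) v =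
      σ * L F fun s => A (v s)

/-- The sign produced by the Hodge dual cancels the twist of `L`. Since the double dual is a nonzero
scalar, `L` is recovered from the composite, which reduces twisted maps to Schur's lemma. -/
theorem IsTwistedEquivariant.comp_hodgeLinear {t : Fin n}
    {L : (ModelSpace n [⋀^Fin p]→L[ℝ] ℝ) →ₗ[ℝ] (ModelSpace n [⋀^Fin r]→ₗ[ℝ] ℝ)}
    (hL : IsTwistedEquivariant t L) (h' : q + p = n) :
    IsEquivariant (minkowski t) (L.comp (hodgeLinear h' t (stdVol n))) := by
  intro A hA F v
  obtain ⟨σ, hσ, hAσ⟩ := exists_stdVol_comp_isometry hA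
  rw [LinearMap.comp_apply, hodgeLinear_comp_isometry h' hA hσ hAσ, map_smul,
    AlternatingMap.smul_apply, hL A σ hA hσ hAσ, smul_eq_mul, ← mul_assoc, hσ, one_mul]
  rfl

theorem IsTwistedEquivariant.eq_zero {t : Fin n}
    {L : (ModelSpace n [⋀^Fin p]→L[ℝ] ℝ) →ₗ[ℝ] (ModelSpace n [⋀^Fin r]→ₗ[ℝ] ℝ)}
    (hL : IsTwistedEquivariant t L) (h : p + q = n) (hr : r ≠ q) : L = 0 := by
  have h' : q + p = n := by omega
  obtain ⟨c, hc, hcF⟩ := exists_hodgeLinear_hodgeLinear h t h'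
  have h0 := (hL.comp_hodgeLinear h').eq_zero hr
  ext1 F
  have h1 := LinearMap.congr_fun h0 (hodgeLinear h t (stdVol n) F)
  rw [LinearMap.comp_apply, hcF, map_smul] at h1
  exact (smul_eq_zero.mp h1).resolve_left hc

theorem IsTwistedEquivariant.exists_eq_smul {t : Fin n}
    {L : (ModelSpace n [⋀^Fin p]→L[ℝ] ℝ) →ₗ[ℝ] (ModelSpace n [⋀^Fin q]→ₗ[ℝ] ℝ)}
    (hL : IsTwistedEquivariant t L) (h : p + q = n) :
    ∃ b : ℝ, ∀ F, L F = b • (hodgeLinear h t (stdVol n) F).toAlternatingMap := by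
  have h' : q + p = n := by omega
  obtain ⟨c, hc, hcF⟩ := exists_hodgeLinear_hodgeLinear h t h'
  obtain ⟨a, ha⟩ := (hL.comp_hodgeLinear h').exists_eq_smul
  refine ⟨c⁻¹ * a, fun F => ?_⟩
  have h1 := ha (hodgeLinear h t (stdVol n) F)
  rw [LinearMap.comp_apply, hcF, map_smul] at h1
  rw [mul_smul, ← h1, inv_smul_smul₀ hc]

end Hodge

/-! ### Natural operations and their restriction to null forms. -/

section NaturalOperations

variable {n p q r k l : ℕ}

/-- An operation on `p`-forms of Minkowski space, depending on a volume form, with values in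
tensors. It is required to be differentiable and to commute with isometries. -/
structure IsNaturalOperation (t : Fin n)
    (P : (ModelSpace n [⋀^Fin n]→L[ℝ] ℝ) → (ModelSpace n [⋀^Fin p]→L[ℝ] ℝ) →
      CovTensor k (ModelSpace n)) : Prop where
  differentiable : ∀ ε v, Differentiable ℝ fun F => P ε F v
  natural : ∀ A : ModelSpace n ≃L[ℝ] ModelSpace n, IsIsometryOf (minkowski t) A → ∀ ε F v,
    P (ε.compContinuousLinearMap (A : ModelSpace n →L[ℝ] ModelSpace n))
      (F.compContinuousLinearMap (A : ModelSpace n →L[ℝ] ModelSpace n)) v =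
    P ε F fun s => A (v s)

theorem CovTensor.prod_apply {V : Type*} [AddCommGroup V] [Module ℝ V] (S : CovTensor k V)
    (T : CovTensor l V) (v : Fin (k + l) → V) :
    S.prod T v = S (fun s => v (Fin.castAdd l s)) * T fun s => v (Fin.natAdd k s) := by
  simp [CovTensor.prod]

theorem CovTensor.contract_apply {V : Type*} [AddCommGroup V] [Module ℝ V] [TopologicalSpace V]
    (b : Module.Basis (Fin n) ℝ V) (B : V →L[ℝ] V →L[ℝ] ℝ)
    (T : CovTensor (k + 2) V) (v : Fin k → V) :
    T.contract b B v =
      ∑ i, ∑ j, inverseGram b B i j * T (Fin.cons (b i) (Fin.cons (b j) v)) := by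
  simp only [CovTensor.contract, sum_apply, smul_apply, smul_eq_mul, MultilinearMap.curryLeft_apply]

namespace IsNaturalOperation

variable {t : Fin n}

theorem field : IsNaturalOperation t
    fun (_ : ModelSpace n [⋀^Fin n]→L[ℝ] ℝ) (F : ModelSpace n [⋀^Fin p]→L[ℝ] ℝ) =>
      F.toMultilinearMap where
  differentiable ε v := by
    change Differentiable ℝ fun F : ModelSpace n [⋀^Fin p]→L[ℝ] ℝ => F v
    fun_prop
  natural _ _ _ _ _ := rfl

theorem volume : IsNaturalOperation t
    fun (ε : ModelSpace n [⋀^Fin n]→L[ℝ] ℝ) (_ : ModelSpace n [⋀^Fin p]→L[ℝ] ℝ) =>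
      ε.toMultilinearMap where
  differentiable _ _ := differentiable_const _
  natural _ _ _ _ _ := rfl

theorem metric : IsNaturalOperation t
    fun (_ : ModelSpace n [⋀^Fin n]→L[ℝ] ℝ) (_ : ModelSpace n [⋀^Fin p]→L[ℝ] ℝ) =>
      scalarProductTensor (minkowski t) where
  differentiable _ _ := differentiable_const _
  natural _ hA _ _ v := (hA (v 0) (v 1)).symm

variable {P : (ModelSpace n [⋀^Fin n]→L[ℝ] ℝ) → (ModelSpace n [⋀^Fin p]→L[ℝ] ℝ) →
      CovTensor k (ModelSpace n)}
  {Q : (ModelSpace n [⋀^Fin n]→L[ℝ] ℝ) → (ModelSpace n [⋀^Fin p]→L[ℝ] ℝ) →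
      CovTensor l (ModelSpace n)}

theorem hodge {P : (ModelSpace n [⋀^Fin n]→L[ℝ] ℝ) → (ModelSpace n [⋀^Fin p]→L[ℝ] ℝ) →
      (ModelSpace n [⋀^Fin r]→L[ℝ] ℝ)}
    (hP : IsNaturalOperation t fun ε F => (P ε F).toMultilinearMap) (h : r + q = n) :
    IsNaturalOperation t
      fun ε F => (hodgeDual h (stdBasis n) (minkowski t) ε (P ε F)).toMultilinearMap where
  differentiable ε v := by
    change Differentiable ℝ fun F => hodgeDual h (stdBasis n) (minkowski t) ε (P ε F) v
    have h1 : ∀ v, Differentiable ℝ fun F => P ε F v := hP.differentiable ε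
    simp only [hodgeDual_apply]
    exact .const_mul (.fun_sum fun i _ => .fun_sum fun j _ => ((h1 _).const_mul _).mul_const _) _
  natural A hA ε F v := by
    have h1 : P (ε.compContinuousLinearMap (A : ModelSpace n →L[ℝ] ModelSpace n))
      (F.compContinuousLinearMap (A : ModelSpace n →L[ℝ] ModelSpace n)) =
      (P ε F).compContinuousLinearMap (A : ModelSpace n →L[ℝ] ModelSpace n) :=
      ContinuousAlternatingMap.ext fun v => hP.natural A hA ε F v
    rw [h1, hodgeDual_pullback h (stdBasis n) (stdBasis n) hA]
    rfl

theorem add {Q : (ModelSpace n [⋀^Fin n]→L[ℝ] ℝ) → (ModelSpace n [⋀^Fin p]→L[ℝ] ℝ) →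
      CovTensor k (ModelSpace n)} (hP : IsNaturalOperation t P) (hQ : IsNaturalOperation t Q) :
    IsNaturalOperation t fun ε F => P ε F + Q ε F where
  differentiable ε v := (hP.differentiable ε v).add (hQ.differentiable ε v)
  natural A hA ε F v := congrArg₂ (· + ·) (hP.natural A hA ε F v) (hQ.natural A hA ε F v)

theorem const_smul (hP : IsNaturalOperation t P) (c : ℝ) :
    IsNaturalOperation t fun ε F => c • P ε F where
  differentiable ε v := (hP.differentiable ε v).const_mul c
  natural A hA ε F v := congrArg (c * ·) (hP.natural A hA ε F v)

theorem prod (hP : IsNaturalOperation t P) (hQ : IsNaturalOperation t Q) :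
    IsNaturalOperation t fun ε F => (P ε F).prod (Q ε F) where
  differentiable ε v := by
    simp only [CovTensor.prod_apply]
    exact (hP.differentiable ε _).mul (hQ.differentiable ε _)
  natural A hA ε F v := by
    simp only [CovTensor.prod_apply, hP.natural A hA, hQ.natural A hA]

theorem perm (hP : IsNaturalOperation t P) (σ : Equiv.Perm (Fin k)) :
    IsNaturalOperation t fun ε F => (P ε F).domDomCongr σ where
  differentiable ε v := hP.differentiable ε fun s => v (σ s)
  natural A hA ε F v := hP.natural A hA ε F fun s => v (σ s)

theorem contract {P : (ModelSpace n [⋀^Fin n]→L[ℝ] ℝ) → (ModelSpace n [⋀^Fin p]→L[ℝ] ℝ) →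
      CovTensor (k + 2) (ModelSpace n)} (hP : IsNaturalOperation t P) :
    IsNaturalOperation t fun ε F => (P ε F).contract (stdBasis n) (minkowski t) where
  differentiable ε v := by
    simp only [CovTensor.contract_apply]
    exact .fun_sum fun i _ => .fun_sum fun j _ => (hP.differentiable ε _).const_mul _
  natural A hA ε F v := by
    rw [← contract_pullback (stdBasis n) (stdBasis n) hA]
    congr 2
    ext v
    exact hP.natural A hA ε F v

/-- This trades a rescaling of `F` for a boost of the arguments, which is how homogeneity in `c`
enters. -/
theorem apply_boost (hP : IsNaturalOperation t P) {A : ModelSpace n ≃L[ℝ] ModelSpace n}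
    (hA : IsIsometryOf (minkowski t) A) {ε : ModelSpace n [⋀^Fin n]→L[ℝ] ℝ}
    (hε : ε.compContinuousLinearMap (A : ModelSpace n →L[ℝ] ModelSpace n) = ε)
    {F : ModelSpace n [⋀^Fin p]→L[ℝ] ℝ} {c : ℝ}
    (hF : F.compContinuousLinearMap (A : ModelSpace n →L[ℝ] ModelSpace n) = c • F)
    (v : Fin k → ModelSpace n) : P ε (c • F) v = P ε F fun s => A (v s) := by
  rw [← hP.natural A hA, hε, hF]

theorem differentiable_scale (hP : IsNaturalOperation t P) (ε : ModelSpace n [⋀^Fin n]→L[ℝ] ℝ)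
    (F : ModelSpace n [⋀^Fin p]→L[ℝ] ℝ) (v : Fin k → ModelSpace n) :
    Differentiable ℝ fun c : ℝ => P ε (c • F) v :=
  (hP.differentiable ε v).comp (differentiable_id.smul_const F)

end IsNaturalOperation

/-- In the first two cases `φ` is affine on the positive axis, and its value and one-sided
derivative at `0` determine it there. The inverse scaling is compatible with continuity at `0` only
if `φ 1 = 0`. -/
theorem eq_add_deriv_of_homogeneous {φ : ℝ → ℝ} (hφ : Differentiable ℝ φ)
    (h : (∀ c, 0 < c → φ c = φ 1) ∨ (∀ c, 0 < c → φ c = c * φ 1) ∨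
      (∀ c, 0 < c → φ c = c⁻¹ * φ 1)) :
    φ 1 = φ 0 + deriv φ 0 := by
  have affine : ∀ a b : ℝ, (∀ c, 0 < c → φ c = a + c * b) → φ 1 = φ 0 + deriv φ 0 := by
    intro a b hab
    have h0 : φ 0 = a := by
      have h1 : Filter.Tendsto φ (nhdsWithin 0 (Set.Ioi 0)) (nhds (φ 0)) :=
        hφ.continuous.continuousAt.tendsto.mono_left nhdsWithin_le_nhds
      have h2 : Filter.Tendsto (fun c : ℝ => a + c * b) (nhdsWithin 0 (Set.Ioi 0))
          (nhds (a + 0 * b)) :=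
        (Continuous.tendsto (by fun_prop) 0).mono_left nhdsWithin_le_nhds
      have h3 : φ =ᶠ[nhdsWithin 0 (Set.Ioi 0)] fun c : ℝ => a + c * b :=
        Filter.eventuallyEq_of_mem self_mem_nhdsWithin fun c hc => hab c hc
      have := tendsto_nhds_unique (h1.congr' h3) h2
      simpa using this
    have hd : deriv φ 0 = b := by
      have h1 : HasDerivWithinAt φ (deriv φ 0) (Set.Ici 0) 0 :=
        (hφ 0).hasDerivAt.hasDerivWithinAt
      have h2 : HasDerivWithinAt φ b (Set.Ici 0) 0 := by
        have h3 : HasDerivWithinAt (fun c : ℝ => a + c * b) b (Set.Ici 0) 0 := by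
          have := ((hasDerivAt_id (0 : ℝ)).mul_const b).const_add a
          simpa using this.hasDerivWithinAt
        refine h3.congr (fun c hc => ?_) (by simpa using h0)
        rcases eq_or_lt_of_le (Set.mem_Ici.mp hc) with rfl | hc
        · simpa using h0
        · exact hab c hc
      exact (uniqueDiffOn_Ici (0 : ℝ) 0 Set.self_mem_Ici).eq_deriv _ h1 h2
    rw [h0, hd, hab 1 one_pos, one_mul]
  rcases h with h | h | h
  · exact affine (φ 1) 0 fun c hc => by simpa using h c hc
  · exact affine 0 (φ 1) fun c hc => by simpa using h c hc
  · have h1 : φ 1 = 0 := by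
      have h2 : Filter.Tendsto (fun c : ℝ => c * φ c) (nhdsWithin 0 (Set.Ioi 0))
          (nhds (0 * φ 0)) :=
        (Continuous.tendsto (continuous_id.mul hφ.continuous) 0).mono_left nhdsWithin_le_nhds
      have h3 : (fun c : ℝ => c * φ c) =ᶠ[nhdsWithin 0 (Set.Ioi 0)] fun _ => φ 1 :=
        Filter.eventuallyEq_of_mem self_mem_nhdsWithin fun c (hc : 0 < c) => by
          simp only [h c hc, mul_inv_cancel_left₀ hc.ne']
      have := tendsto_nhds_unique (h2.congr' h3) tendsto_const_nhds
      simpa using this.symm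
    exact affine 0 0 fun c hc => by rw [h c hc, h1]; simp

namespace IsNaturalOperation

variable {t : Fin n}

/-- Scalar invariants of null forms vanish, up to a constant. -/
theorem scalar_eq {P : (ModelSpace n [⋀^Fin n]→L[ℝ] ℝ) → (ModelSpace n [⋀^Fin p]→L[ℝ] ℝ) →
      CovTensor 0 (ModelSpace n)} (hP : IsNaturalOperation t P)
    {F : ModelSpace n [⋀^Fin p]→L[ℝ] ℝ} (hF : IsNullAt (minkowski t) F)
    {ε : ModelSpace n [⋀^Fin n]→L[ℝ] ℝ} (hε : ε = stdVol n ∨ ε = -stdVol n)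
    (v : Fin 0 → ModelSpace n) : P ε F v = P (stdVol n) 0 v := by
  have h1 : P ε F v = P ε 0 v := by
    obtain ⟨f, w, hfw, -⟩ := hF.exists_boosts
    -- A tensor of rank 0 has no arguments to boost, so it is unchanged when `F` is rescaled.
    have h2 : ∀ c : ℝ, 0 < c → P ε (c • F) v = P ε F v := by
      intro c hc
      obtain ⟨A, hA, -, hAε, hAF⟩ := hfw c hc
      rw [hP.apply_boost hA (hAε ε) hAF]
      exact congrArg _ (Subsingleton.elim _ _)
    have h3 : Filter.Tendsto (fun c : ℝ => P ε (c • F) v) (nhdsWithin 0 (Set.Ioi 0))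
        (nhds (P ε ((0 : ℝ) • F) v)) :=
      ((hP.differentiable_scale ε F v).continuous.tendsto 0).mono_left nhdsWithin_le_nhds
    have h4 : (fun c : ℝ => P ε (c • F) v) =ᶠ[nhdsWithin 0 (Set.Ioi 0)] fun _ => P ε F v :=
      Filter.eventuallyEq_of_mem self_mem_nhdsWithin fun c hc => h2 c hc
    have := tendsto_nhds_unique (h3.congr' h4) tendsto_const_nhds
    rw [zero_smul] at this
    exact this.symm
  rw [h1]
  rcases hε with rfl | rfl
  · rfl
  -- Reflecting one coordinate reverses the volume form and fixes the zero form, so the value at `0`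
  -- does not depend on the orientation.
  · have h2 := hP.natural (coordReflection t) (isIsometryOf_coordReflection t t) (stdVol n) 0 v
    rw [volume_comp_dilated (stdBasis n) (coordReflection_stdBasis t),
      Finset.prod_ite_eq' Finset.univ t, if_pos (Finset.mem_univ t)] at h2
    have h3 : (-1 : ℝ) • stdVol n = -stdVol n := by ext; simp
    have h4 : (0 : ModelSpace n [⋀^Fin p]→L[ℝ] ℝ).compContinuousLinearMap
        (coordReflection t : ModelSpace n →L[ℝ] ModelSpace n) = 0 := rfl
    rw [h3, h4] at h2
    rw [h2]
    exact congrArg _ (Subsingleton.elim _ _)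

/-- The antisymmetrization of a tensor-valued operation. -/
def antisymmetrize (P : (ModelSpace n [⋀^Fin n]→L[ℝ] ℝ) → (ModelSpace n [⋀^Fin p]→L[ℝ] ℝ) →
      CovTensor r (ModelSpace n)) (ε : ModelSpace n [⋀^Fin n]→L[ℝ] ℝ)
    (F : ModelSpace n [⋀^Fin p]→L[ℝ] ℝ) : ModelSpace n [⋀^Fin r]→ₗ[ℝ] ℝ :=
  ((r.factorial : ℝ)⁻¹) • MultilinearMap.alternatization (P ε F)

theorem antisymmetrize_apply
    (P : (ModelSpace n [⋀^Fin n]→L[ℝ] ℝ) → (ModelSpace n [⋀^Fin p]→L[ℝ] ℝ) →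
      CovTensor r (ModelSpace n)) (ε : ModelSpace n [⋀^Fin n]→L[ℝ] ℝ)
    (F : ModelSpace n [⋀^Fin p]→L[ℝ] ℝ) (v : Fin r → ModelSpace n) :
    antisymmetrize P ε F v = ((r.factorial : ℝ)⁻¹) *
      ∑ σ : Equiv.Perm (Fin r), ((Equiv.Perm.sign σ : ℤ) : ℝ) * P ε F fun s => v (σ s) := by
  simp only [antisymmetrize, AlternatingMap.smul_apply, MultilinearMap.alternatization_apply,
    smul_eq_mul, Units.smul_def, zsmul_eq_mul]
  rfl

theorem antisymmetrize_of_alternating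
    {P : (ModelSpace n [⋀^Fin n]→L[ℝ] ℝ) → (ModelSpace n [⋀^Fin p]→L[ℝ] ℝ) →
      CovTensor r (ModelSpace n)} {ε : ModelSpace n [⋀^Fin n]→L[ℝ] ℝ}
    {F : ModelSpace n [⋀^Fin p]→L[ℝ] ℝ} {G : ModelSpace n [⋀^Fin r]→ₗ[ℝ] ℝ}
    (hG : P ε F = G) : antisymmetrize P ε F = G := by
  have hr : (r.factorial : ℝ) ≠ 0 := by positivity
  rw [antisymmetrize, hG, AlternatingMap.coe_alternatization, Fintype.card_fin,
    ← Nat.cast_smul_eq_nsmul ℝ, inv_smul_smul₀ hr]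

variable {P : (ModelSpace n [⋀^Fin n]→L[ℝ] ℝ) → (ModelSpace n [⋀^Fin p]→L[ℝ] ℝ) →
      CovTensor r (ModelSpace n)}

theorem antisymmetrized (hP : IsNaturalOperation t P) :
    IsNaturalOperation t fun ε F => (antisymmetrize P ε F).toMultilinearMap where
  differentiable ε v := by
    change Differentiable ℝ fun F => antisymmetrize P ε F v
    simp only [antisymmetrize_apply]
    exact .const_mul (.fun_sum fun σ _ => (hP.differentiable ε _).const_mul _) _
  natural A hA ε F v := by
    change antisymmetrize P _ _ v = antisymmetrize P _ _ _
    simp only [antisymmetrize_apply, hP.natural A hA]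

section Linearize

variable {Q : (ModelSpace n [⋀^Fin n]→L[ℝ] ℝ) → (ModelSpace n [⋀^Fin p]→L[ℝ] ℝ) →
      (ModelSpace n [⋀^Fin r]→ₗ[ℝ] ℝ)}

theorem differentiable_form (hQ : IsNaturalOperation t fun ε F => (Q ε F).toMultilinearMap)
    (ε : ModelSpace n [⋀^Fin n]→L[ℝ] ℝ) (v : Fin r → ModelSpace n) :
    Differentiable ℝ fun F => Q ε F v := hQ.differentiable ε v

variable (hQ : IsNaturalOperation t fun ε F => (Q ε F).toMultilinearMap)

/-- The linear part at `0` of a natural operation with values in forms. -/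
def linearize (ε : ModelSpace n [⋀^Fin n]→L[ℝ] ℝ) :
    (ModelSpace n [⋀^Fin p]→L[ℝ] ℝ) →ₗ[ℝ] (ModelSpace n [⋀^Fin r]→ₗ[ℝ] ℝ) where
  toFun F :=
    { toFun := fun v => fderiv ℝ (fun G => Q ε G v) 0 F
      map_update_add' := fun {inst} v i x y => by
        cases Subsingleton.elim inst (instDecidableEqFin r)
        simp only [AlternatingMap.map_update_add]
        rw [fderiv_fun_add (hQ.differentiable_form ε _ 0) (hQ.differentiable_form ε _ 0)]
        rfl
      map_update_smul' := fun {inst} v i c x => by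
        cases Subsingleton.elim inst (instDecidableEqFin r)
        simp only [AlternatingMap.map_update_smul]
        rw [fderiv_fun_const_smul (hQ.differentiable_form ε _ 0)]
        rfl
      map_eq_zero_of_eq' := fun v i j hij hne => by
        have : (fun G => Q ε G v) = fun _ => 0 :=
          funext fun G => (Q ε G).map_eq_zero_of_eq v hij hne
        rw [this, fderiv_fun_const]
        rfl }
  map_add' F G := AlternatingMap.ext fun v => map_add (fderiv ℝ (fun G => Q ε G v) 0) F G
  map_smul' c F := AlternatingMap.ext fun v => map_smul (fderiv ℝ (fun G => Q ε G v) 0) c F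

theorem linearize_apply (ε : ModelSpace n [⋀^Fin n]→L[ℝ] ℝ) (F : ModelSpace n [⋀^Fin p]→L[ℝ] ℝ)
    (v : Fin r → ModelSpace n) :
    hQ.linearize ε F v = deriv (fun c : ℝ => Q ε (c • F) v) 0 := by
  have h1 : HasFDerivAt (fun G => Q ε G v) (fderiv ℝ (fun G => Q ε G v) 0) ((0 : ℝ) • F) := by
    rw [zero_smul]
    exact (hQ.differentiable_form ε v 0).hasFDerivAt
  have h2 : HasDerivAt (fun c : ℝ => c • F) F 0 := by
    simpa using (hasDerivAt_id (0 : ℝ)).smul_const F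
  exact (h1.comp_hasDerivAt (0 : ℝ) h2).deriv.symm

/-- Differentiate the naturality of `Q` along `c • F` at `c = 0`. -/
theorem linearize_natural (A : ModelSpace n ≃L[ℝ] ModelSpace n)
    (hA : IsIsometryOf (minkowski t) A) (ε : ModelSpace n [⋀^Fin n]→L[ℝ] ℝ)
    (F : ModelSpace n [⋀^Fin p]→L[ℝ] ℝ) (v : Fin r → ModelSpace n) :
    hQ.linearize (ε.compContinuousLinearMap (A : ModelSpace n →L[ℝ] ModelSpace n))
      (F.compContinuousLinearMap (A : ModelSpace n →L[ℝ] ModelSpace n)) v =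
    hQ.linearize ε F fun s => A (v s) := by
  rw [linearize_apply, linearize_apply]
  congr 1
  ext1 c
  exact hQ.natural A hA ε (c • F) v

/-- On null forms, an operation with values in forms is affine. -/
theorem eq_add_linearize (ε : ModelSpace n [⋀^Fin n]→L[ℝ] ℝ)
    {F : ModelSpace n [⋀^Fin p]→L[ℝ] ℝ} (hF : IsNullAt (minkowski t) F) :
    Q ε F = Q ε 0 + hQ.linearize ε F := by
  obtain ⟨f, w, hfw, hw⟩ := hF.exists_boosts
  refine f.ext_alternating fun j hj => ?_
  have h1 : ∀ c : ℝ, 0 < c → Q ε (c • F) (fun s => f (j s)) =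
      (∏ s, w c (j s)) * Q ε F fun s => f (j s) := by
    intro c hc
    obtain ⟨A, hA, hAf, hAε, hAF⟩ := hfw c hc
    refine (hQ.apply_boost hA (hAε ε) hAF _).trans ?_
    simp only [hAf]
    exact (Q ε F).toMultilinearMap.map_smul_univ (fun s => w c (j s)) fun s => f (j s)
  have h2 := eq_add_deriv_of_homogeneous (hQ.differentiable_scale ε F fun s => f (j s)) (by
    have h3 : Q ε ((1 : ℝ) • F) = Q ε F := by rw [one_smul]
    change (∀ c : ℝ, 0 < c → Q ε (c • F) _ = Q ε ((1 : ℝ) • F) _) ∨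
      (∀ c : ℝ, 0 < c → Q ε (c • F) _ = c * Q ε ((1 : ℝ) • F) _) ∨
      (∀ c : ℝ, 0 < c → Q ε (c • F) _ = c⁻¹ * Q ε ((1 : ℝ) • F) _)
    rw [h3]
    rcases hw r j hj with h | h | h
    · exact Or.inl fun c hc => by rw [h1 c hc, h c hc, one_mul]
    · exact Or.inr (Or.inl fun c hc => by rw [h1 c hc, h c hc])
    · exact Or.inr (Or.inr fun c hc => by rw [h1 c hc, h c hc]))
  have h4 : Q ε ((1 : ℝ) • F) (fun s => f (j s)) = Q ε ((0 : ℝ) • F) (fun s => f (j s)) +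
    deriv (fun c : ℝ => Q ε (c • F) fun s => f (j s)) 0 := h2
  rw [one_smul, zero_smul, ← hQ.linearize_apply] at h4
  exact h4

/-- The part of the linearization that does not depend on the orientation. -/
def evenPart : (ModelSpace n [⋀^Fin p]→L[ℝ] ℝ) →ₗ[ℝ] (ModelSpace n [⋀^Fin r]→ₗ[ℝ] ℝ) :=
  (2⁻¹ : ℝ) • (hQ.linearize (stdVol n) + hQ.linearize (-stdVol n))

/-- The part of the linearization that changes sign with the orientation. -/
def oddPart : (ModelSpace n [⋀^Fin p]→L[ℝ] ℝ) →ₗ[ℝ] (ModelSpace n [⋀^Fin r]→ₗ[ℝ] ℝ) :=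
  (2⁻¹ : ℝ) • (hQ.linearize (stdVol n) - hQ.linearize (-stdVol n))

theorem evenPart_apply (F : ModelSpace n [⋀^Fin p]→L[ℝ] ℝ) (v : Fin r → ModelSpace n) :
    hQ.evenPart F v =
      2⁻¹ * (hQ.linearize (stdVol n) F v + hQ.linearize (-stdVol n) F v) := rfl

theorem oddPart_apply (F : ModelSpace n [⋀^Fin p]→L[ℝ] ℝ) (v : Fin r → ModelSpace n) :
    hQ.oddPart F v =
      2⁻¹ * (hQ.linearize (stdVol n) F v - hQ.linearize (-stdVol n) F v) := rfl

theorem neg_volume_comp (ε : ModelSpace n [⋀^Fin n]→L[ℝ] ℝ)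
    (A : ModelSpace n →L[ℝ] ModelSpace n) :
    (-ε).compContinuousLinearMap A = -ε.compContinuousLinearMap A := rfl

theorem volume_eq_of_sign {A : ModelSpace n ≃L[ℝ] ModelSpace n} {σ : ℝ} (hσ : σ * σ = 1)
    (h : (stdVol n).compContinuousLinearMap (A : ModelSpace n →L[ℝ] ModelSpace n) =
      σ • stdVol n) :
    (σ = 1 ∧ (stdVol n).compContinuousLinearMap (A : ModelSpace n →L[ℝ] ModelSpace n) =
      stdVol n) ∨
    (σ = -1 ∧ (stdVol n).compContinuousLinearMap (A : ModelSpace n →L[ℝ] ModelSpace n) =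
      -stdVol n) := by
  rcases mul_self_eq_one_iff.mp hσ with rfl | rfl
  · exact Or.inl ⟨rfl, by rw [h, one_smul]⟩
  · exact Or.inr ⟨rfl, by rw [h]; ext; simp⟩

/-- An isometry with sign `-1` exchanges the linearizations at `stdVol` and `-stdVol`. Their sum is
invariant under this exchange, and their difference changes sign. -/
theorem evenPart_equivariant : IsEquivariant (minkowski t) hQ.evenPart := by
  intro A hA F v
  obtain ⟨σ, hσ, h⟩ := exists_stdVol_comp_isometry hA
  have h1 := hQ.linearize_natural A hA (stdVol n) F v
  have h2 := hQ.linearize_natural A hA (-stdVol n) F v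
  rw [neg_volume_comp] at h2
  rw [evenPart_apply, evenPart_apply]
  rcases volume_eq_of_sign hσ h with ⟨rfl, h3⟩ | ⟨rfl, h3⟩
  · rw [h3] at h1 h2
    rw [h1, h2]
  · rw [h3] at h1 h2
    rw [neg_neg] at h2
    rw [h1, h2, add_comm]

theorem oddPart_twistedEquivariant : IsTwistedEquivariant t hQ.oddPart := by
  intro A σ hA hσ h F v
  have h1 := hQ.linearize_natural A hA (stdVol n) F v
  have h2 := hQ.linearize_natural A hA (-stdVol n) F v
  rw [neg_volume_comp] at h2
  rw [oddPart_apply, oddPart_apply]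
  rcases volume_eq_of_sign hσ h with ⟨rfl, h3⟩ | ⟨rfl, h3⟩
  · rw [h3] at h1 h2
    rw [h1, h2, one_mul]
  · rw [h3] at h1 h2
    rw [neg_neg] at h2
    rw [h1, h2]
    ring

theorem apply_zero_flip (hQ : IsNaturalOperation t fun ε F => (Q ε F).toMultilinearMap)
    (m : Fin n) {ε : ModelSpace n [⋀^Fin n]→L[ℝ] ℝ} {j : Fin r → Fin n}
    (hj : Function.Injective j) :
    (Q (-ε) 0) (fun s => stdBasis n (j s)) =
      (if m ∈ Set.range j then -1 else 1) * Q ε 0 fun s => stdBasis n (j s) := by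
  have h1 := hQ.natural (coordReflection m) (isIsometryOf_coordReflection t m) ε 0
    fun s => stdBasis n (j s)
  rw [volume_comp_dilated (stdBasis n) (coordReflection_stdBasis m),
    Finset.prod_ite_eq' Finset.univ m, if_pos (Finset.mem_univ m)] at h1
  have h3 : (-1 : ℝ) • ε = -ε := by ext; simp
  have h4 : (0 : ModelSpace n [⋀^Fin p]→L[ℝ] ℝ).compContinuousLinearMap
      (coordReflection m : ModelSpace n →L[ℝ] ModelSpace n) = 0 := rfl
  rw [h3, h4] at h1
  exact h1.trans (form_apply_coordReflection m (Q ε 0) hj)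

/-- The value at `0` of an operation with values in forms vanishes unless the degree of
these forms is `0` or `n`. -/
theorem apply_zero_eq_zero
    (hQ : IsNaturalOperation t fun ε F => (Q ε F).toMultilinearMap) (hr0 : 0 < r) (hrn : r ≠ n) {ε : ModelSpace n [⋀^Fin n]→L[ℝ] ℝ} :
    Q ε 0 = 0 := by
  refine (stdBasis n).ext_alternating fun j hj => ?_
  have hflip := fun m => hQ.apply_zero_flip m (ε := ε) hj
  -- Reflections in an index outside `j` and in one inside `j` both reverse the volume form but act
  -- on the component with opposite signs, so the component equals its own negative.
  obtain ⟨m, hm⟩ : ∃ m, m ∉ Set.range j := by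
    by_contra! h
    have := Fintype.card_of_bijective (f := j) ⟨hj, h⟩
    simp at this
    omega
  have h1 := hflip m
  have h2 := hflip (j ⟨0, hr0⟩)
  rw [if_neg hm] at h1
  rw [if_pos ⟨_, rfl⟩, h1] at h2
  change _ = (0 : ℝ)
  linarith

/-- The value at `0` of an operation with values in top-degree forms is a multiple of the volume
form. -/
theorem apply_zero_eq_smul_volume
    {Q : (ModelSpace n [⋀^Fin n]→L[ℝ] ℝ) → (ModelSpace n [⋀^Fin p]→L[ℝ] ℝ) →
      (ModelSpace n [⋀^Fin n]→ₗ[ℝ] ℝ)}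
    (hQ : IsNaturalOperation t fun ε F => (Q ε F).toMultilinearMap)
    {ε : ModelSpace n [⋀^Fin n]→L[ℝ] ℝ} (hε : ε = stdVol n ∨ ε = -stdVol n) :
    Q ε 0 = (Q (stdVol n) 0 (stdBasis n)) • ε.toAlternatingMap := by
  have hdet := AlternatingMap.eq_smul_basis_det (stdBasis n)
  have hone : (stdVol n).toAlternatingMap (stdBasis n) = 1 := stdVol_stdBasis
  have hvol : (stdVol n).toAlternatingMap = (stdBasis n).det := by
    rw [hdet (stdVol n).toAlternatingMap, hone, one_smul]
  rcases hε with rfl | rfl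
  · rw [hvol, ← hdet]
  · have h1 : (-stdVol n).toAlternatingMap = -(stdBasis n).det := by rw [← hvol]; rfl
    have h2 : Q (-stdVol n) 0 (stdBasis n) = -Q (stdVol n) 0 (stdBasis n) := by
      have := hQ.apply_zero_flip t (ε := stdVol n) (j := id) Function.injective_id
      rw [if_pos ⟨t, rfl⟩, neg_one_mul] at this
      exact this
    rw [h1, hdet (Q (-stdVol n) 0), h2]
    ext v
    simp

end Linearize

end IsNaturalOperation

/-- An alternating map on `ℝⁿ`, as a continuous alternating map. -/
def toContinuousForm (G : ModelSpace n [⋀^Fin r]→ₗ[ℝ] ℝ) : ModelSpace n [⋀^Fin r]→L[ℝ] ℝ :=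
  { G with
    cont := by
      have h : ∀ v : Fin r → ModelSpace n, G v =
          ∑ j : Fin r → Fin n, (∏ s, v s (j s)) * G fun s => stdBasis n (j s) := by
        intro v
        have hv : v = fun s => ∑ i, v s i • stdBasis n i := by
          ext s k
          simp [stdBasis_apply]
        conv_lhs => rw [hv]
        refine (G.toMultilinearMap.map_sum _).trans (Finset.sum_congr rfl fun j _ => ?_)
        exact G.toMultilinearMap.map_smul_univ (fun s => v s (j s)) fun s => stdBasis n (j s)
      change Continuous G
      rw [show (G : (Fin r → ModelSpace n) → ℝ) = _ from funext h]
      fun_prop }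

end NaturalOperations

/-! ### Elementary closed forms and their linear combinations. -/

section ClosedForms

variable {n p q r k : ℕ} {M : Type*} [TopologicalSpace M] [ChartedSpace (ModelSpace n) M]

theorem FormField.inChart_add (α β : FormField n M p)
    (e : OpenPartialHomeomorph M (ModelSpace n)) :
    (α + β).inChart e = α.inChart e + β.inChart e := rfl

theorem FormField.inChart_smul (c : ℝ) (α : FormField n M p)
    (e : OpenPartialHomeomorph M (ModelSpace n)) :
    (c • α).inChart e = c • α.inChart e := rfl

theorem FormField.IsSmooth.differentiableAt {α : FormField n M p} (hα : α.IsSmooth) (x : M) :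
    DifferentiableAt ℝ (α.inChart (chartAt (ModelSpace n) x)) (chartAt (ModelSpace n) x x) :=
  ((hα _ (chart_mem_atlas _ x)).contDiffAt ((chartAt (ModelSpace n) x).open_target.mem_nhds
    (mem_chart_target _ x))).differentiableAt (by simp)

theorem FormField.IsClosed.add {α β : FormField n M p} (hα : α.IsClosed) (hβ : β.IsClosed) :
    (α + β).IsClosed := by
  refine ⟨fun e he => (hα.1 e he).add (hβ.1 e he), funext fun x => ?_⟩
  have h1 := congrFun hα.2 x
  have h2 := congrFun hβ.2 x
  unfold FormField.d at h1 h2 ⊢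
  rw [FormField.inChart_add, extDeriv_add (hα.1.differentiableAt x) (hβ.1.differentiableAt x)]
  refine (congrArg₂ (· + ·) h1 h2).trans ?_
  exact add_zero (0 : TangentSpace (𝓡 n) x [⋀^Fin (p + 1)]→L[ℝ] ℝ)

theorem FormField.IsClosed.const_smul {α : FormField n M p} (hα : α.IsClosed) (c : ℝ) :
    (c • α).IsClosed := by
  refine ⟨fun e he => (hα.1 e he).const_smul c, funext fun x => ?_⟩
  have h1 := congrFun hα.2 x
  unfold FormField.d at h1 ⊢
  rw [FormField.inChart_smul, extDeriv_smul]
  refine (congrArg (c • ·) h1).trans ?_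
  exact smul_zero (A := TangentSpace (𝓡 n) x [⋀^Fin (p + 1)]→L[ℝ] ℝ) c

theorem FormField.isClosed_of_inChart_const {α : FormField n M p}
    (K : ModelSpace n [⋀^Fin p]→L[ℝ] ℝ) (hα : ∀ e, α.inChart e = fun _ => K) : α.IsClosed := by
  refine ⟨fun e _ => by rw [hα]; exact contDiffOn_const, funext fun x => ?_⟩
  have h : extDeriv (fun _ : ModelSpace n => K) (chartAt (ModelSpace n) x x) = 0 := by
    rw [extDeriv, fderiv_fun_const]
    exact map_zero (ContinuousAlternatingMap.alternatizeUncurryFinCLM ℝ (ModelSpace n) ℝ)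
  unfold FormField.d
  rw [hα, h]
  rfl

theorem FormField.isClosed_zero : (0 : FormField n M p).IsClosed :=
  FormField.isClosed_of_inChart_const 0 fun _ => rfl

/-- A constant function, as a form of degree `0`. -/
def FormField.const (c : ℝ) : FormField n M 0 :=
  fun _ => ContinuousAlternatingMap.constOfIsEmpty ℝ _ _ c

theorem FormField.isClosed_const (c : ℝ) : (FormField.const c : FormField n M 0).IsClosed :=
  FormField.isClosed_of_inChart_const (ContinuousAlternatingMap.constOfIsEmpty ℝ _ _ c)
    fun _ => rfl

/-- There are no nonzero `(n+1)`-forms in dimension `n`, because an alternating map is determined by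
its values on distinct basis vectors. -/
theorem FormField.isClosed_of_top {α : FormField n M n} (hα : α.IsSmooth) : α.IsClosed := by
  refine ⟨hα, funext fun x => ?_⟩
  refine form_ext_basis (tangentBasis x) fun j hj => absurd (Fintype.card_le_of_injective j hj) ?_
  simp

theorem FormField.isClosed_of_isEmpty [IsEmpty M] (α : FormField n M p) : α.IsClosed := by
  refine ⟨fun e _ y _ => isEmptyElim (e.symm y), funext fun x => isEmptyElim x⟩

end ClosedForms

/-! ### Orthonormal frames and the passage from natural operations to forms on the spacetime. -/

section Frames

variable {n p q r k : ℕ} {M : Type*} [TopologicalSpace M] [ChartedSpace (ModelSpace n) M]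
  [IsManifold (𝓡 n) ∞ M]

/-- An orthonormal frame at `x`, as an isometry from Minkowski space. -/
def OrientedSpacetime.IsFrame (S : OrientedSpacetime n M) (t : Fin n) (x : M)
    (E : ModelSpace n ≃L[ℝ] TangentSpace (𝓡 n) x) : Prop :=
  ∀ v w, S.metric x (E v) (E w) = minkowski t v w

theorem OrientedSpacetime.exists_isFrame (S : OrientedSpacetime n M) (t : Fin n) (x : M) :
    ∃ E, S.IsFrame t x E := by
  obtain ⟨t', e, he⟩ := S.lorentzian x
  let e' : Module.Basis (Fin n) ℝ (ModelSpace n) := e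
  let E' : ModelSpace n ≃L[ℝ] ModelSpace n :=
    -- The timelike index `t'` of the given basis may depend on `x`. The swap makes `t` the time
    -- index at every point.
    ((stdBasis n).equiv e' (Equiv.swap t t')).toContinuousLinearEquiv
  let E : ModelSpace n ≃L[ℝ] TangentSpace (𝓡 n) x := E'
  refine ⟨E, isIsometryOf_of_basis (A := E.toContinuousLinearMap) (stdBasis n) fun i j => ?_⟩
  have hE : ∀ i, E (stdBasis n i) = e (Equiv.swap t t' i) := fun i =>
    Module.Basis.equiv_apply _ _ _ _
  have hsw : ∀ i, Equiv.swap t t' i = t' ↔ i = t := fun i => by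
    rw [← Equiv.eq_symm_apply, Equiv.symm_swap, Equiv.swap_apply_right]
  rw [ContinuousLinearEquiv.coe_coe, hE, hE, he, stdBasis_minkowski, lorentzGram]
  simp only [EmbeddingLike.apply_eq_iff_eq, hsw]

variable {S : OrientedSpacetime n M} {t : Fin n} {x : M}
  {E : ModelSpace n ≃L[ℝ] TangentSpace (𝓡 n) x}

theorem OrientedSpacetime.IsFrame.vol_eq (hE : S.IsFrame t x E) :
    (S.vol x).compContinuousLinearMap (E : ModelSpace n →L[ℝ] TangentSpace (𝓡 n) x) = stdVol n ∨
    (S.vol x).compContinuousLinearMap (E : ModelSpace n →L[ℝ] TangentSpace (𝓡 n) x) =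
      -stdVol n := by
  refine eq_or_eq_neg_stdVol ?_
  refine (S.vol_sq x fun i => E (stdBasis n i)).trans ?_
  simp only [hE _ _, stdBasis_minkowski]
  exact abs_det_lorentzGram t

theorem OrientedSpacetime.IsFrame.isNullAt (hE : S.IsFrame t x E)
    {F : TangentSpace (𝓡 n) x [⋀^Fin p]→L[ℝ] ℝ} (hF : IsNullAt (S.metric x) F) :
    IsNullAt (minkowski t)
      (F.compContinuousLinearMap (E : ModelSpace n →L[ℝ] TangentSpace (𝓡 n) x)) := by
  obtain ⟨ℓ, h0, h1, h2⟩ := hF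
  refine ⟨E.symm ℓ, by simpa using h0, ?_, fun v => ?_⟩
  · rintro v ⟨i, hi⟩
    exact h1 _ ⟨i, by simp [hi]⟩
  · rw [← h2 fun s => E (v s)]
    refine Finset.sum_congr rfl fun i _ => ?_
    rw [← hE, ContinuousLinearEquiv.apply_symm_apply]
    rfl

theorem OrientedSpacetime.IsFrame.ext (S : OrientedSpacetime n M) (t : Fin n)
    {H K : FormField n M r}
    (h : ∀ x E, S.IsFrame t x E → ∀ v : Fin r → ModelSpace n,
      H x (fun s => E (v s)) = K x fun s => E (v s)) : H = K := by
  funext x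
  obtain ⟨E, hE⟩ := S.exists_isFrame t x
  ext v
  simpa using h x E hE fun s => E.symm (v s)

/-- `S.Represents t F T P` says that the operation `P` computes the components of the tensor field
`T` from those of `F` in all orthonormal frames. -/
def OrientedSpacetime.Represents (S : OrientedSpacetime n M) (t : Fin n) (F : FormField n M p)
    (T : CovTensorField n M k)
    (P : (ModelSpace n [⋀^Fin n]→L[ℝ] ℝ) → (ModelSpace n [⋀^Fin p]→L[ℝ] ℝ) →
      CovTensor k (ModelSpace n)) : Prop :=
  ∀ x E, S.IsFrame t x E → ∀ v : Fin k → ModelSpace n, T x (fun s => E (v s)) =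
    P ((S.vol x).compContinuousLinearMap (E : ModelSpace n →L[ℝ] TangentSpace (𝓡 n) x))
      ((F x).compContinuousLinearMap (E : ModelSpace n →L[ℝ] TangentSpace (𝓡 n) x)) v

theorem OrientedSpacetime.Represents.star {F : FormField n M p} {H : FormField n M r}
    {P : (ModelSpace n [⋀^Fin n]→L[ℝ] ℝ) → (ModelSpace n [⋀^Fin p]→L[ℝ] ℝ) →
      (ModelSpace n [⋀^Fin r]→L[ℝ] ℝ)}
    (hP : S.Represents t F H.toTensor fun ε G => (P ε G).toMultilinearMap) (h : r + q = n) :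
    S.Represents t F (S.star h H).toTensor
      fun ε G => (hodgeDual h (stdBasis n) (minkowski t) ε (P ε G)).toMultilinearMap := by
  intro x E hE v
  have h1 : P ((S.vol x).compContinuousLinearMap (E : ModelSpace n →L[ℝ] TangentSpace (𝓡 n) x))
      ((F x).compContinuousLinearMap (E : ModelSpace n →L[ℝ] TangentSpace (𝓡 n) x)) =
      (H x).compContinuousLinearMap (E : ModelSpace n →L[ℝ] TangentSpace (𝓡 n) x) :=
    ContinuousAlternatingMap.ext fun v => (hP x E hE v).symm
  beta_reduce
  rw [h1, hodgeDual_pullback h (tangentBasis x) (stdBasis n) hE]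
  rfl

/-- Nullity enters only through the scalar coefficients. Invariants of null forms take the same
value at every point and in both orientations, so a coefficient is constant and multiplication by it
is again a natural operation. -/
theorem OrientedSpacetime.AlgebraicPolynomial.exists_represents {h : p + q = n}
    {F : FormField n M p} (hF : S.IsNull F) (t : Fin n) {T : CovTensorField n M k}
    (hT : S.AlgebraicPolynomial h F T) :
    ∃ P : (ModelSpace n [⋀^Fin n]→L[ℝ] ℝ) → (ModelSpace n [⋀^Fin p]→L[ℝ] ℝ) →
      CovTensor k (ModelSpace n), IsNaturalOperation t P ∧ S.Represents t F T P := by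
  induction hT with
  | field => exact ⟨_, .field, fun _ _ _ _ => rfl⟩
  | dual =>
    exact ⟨_, .hodge (P := fun _ F => F) .field h,
      Represents.star (P := fun _ F => F) (fun _ _ _ _ => rfl) h⟩
  | metric => exact ⟨_, .metric, fun x E hE v => hE _ _⟩
  | volume => exact ⟨_, .volume, fun _ _ _ _ => rfl⟩
  | add _ _ ihT ihU =>
    obtain ⟨P, hP, hPT⟩ := ihT
    obtain ⟨Q, hQ, hQU⟩ := ihU
    exact ⟨_, hP.add hQ, fun x E hE v => congrArg₂ (· + ·) (hPT x E hE v) (hQU x E hE v)⟩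
  | prod _ _ ihT ihU =>
    obtain ⟨P, hP, hPT⟩ := ihT
    obtain ⟨Q, hQ, hQU⟩ := ihU
    refine ⟨_, hP.prod hQ, fun x E hE v => ?_⟩
    rw [CovTensor.prod_apply, CovTensor.prod_apply, hPT x E hE, hQU x E hE]
  | perm σ _ ihT =>
    obtain ⟨P, hP, hPT⟩ := ihT
    exact ⟨_, hP.perm σ, fun x E hE v => hPT x E hE fun s => v (σ s)⟩
  | @contract k T _ ihT =>
    obtain ⟨P, hP, hPT⟩ := ihT
    refine ⟨_, hP.contract, fun x E hE v => ?_⟩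
    rw [← contract_pullback (tangentBasis x) (stdBasis n) hE]
    congr 2
    ext v
    exact hPT x E hE v
  | @smul k m T I _ f c _ hcf _ ihI ihT =>
    obtain ⟨P, hP, hPT⟩ := ihT
    choose J hJ hJI using ihI
    have hc : ∀ x, c x = f fun i => J i (stdVol n) 0 Fin.elim0 := by
      intro x
      obtain ⟨E, hE⟩ := S.exists_isFrame t x
      rw [hcf]
      congr 1
      ext1 i
      rw [← (hJ i).scalar_eq (hE.isNullAt (hF x)) hE.vol_eq, ← hJI i x E hE]
      exact congrArg _ (Subsingleton.elim _ _)
    refine ⟨_, hP.const_smul (f fun i => J i (stdVol n) 0 Fin.elim0), fun x E hE v => ?_⟩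
    beta_reduce
    rw [hc x]
    exact congrArg (_ * ·) (hPT x E hE v)

variable {h : p + q = n} {F : FormField n M p}

/-- The value at `0` of an operation with values in forms defines a closed form. -/
theorem OrientedSpacetime.exists_isClosed_apply_zero (S : OrientedSpacetime n M)
    {Q : (ModelSpace n [⋀^Fin n]→L[ℝ] ℝ) → (ModelSpace n [⋀^Fin p]→L[ℝ] ℝ) →
      (ModelSpace n [⋀^Fin r]→ₗ[ℝ] ℝ)}
    (hQ : IsNaturalOperation t fun ε F => (Q ε F).toMultilinearMap) :
    ∃ K : FormField n M r, K.IsClosed ∧ ∀ x E, S.IsFrame t x E → ∀ v : Fin r → ModelSpace n,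
      K x (fun s => E (v s)) = Q ((S.vol x).compContinuousLinearMap
        (E : ModelSpace n →L[ℝ] TangentSpace (𝓡 n) x)) 0 v := by
  by_cases hr0 : r = 0
  · subst hr0
    refine ⟨FormField.const (Q (stdVol n) 0 Fin.elim0), FormField.isClosed_const _,
      fun x E hE v => ?_⟩
    -- The zero form is null with any nonzero vector as `ℓ`, so the constancy of scalar invariants
    -- covers degree `0`.
    have h0 : IsNullAt (minkowski t) (0 : ModelSpace n [⋀^Fin p]→L[ℝ] ℝ) :=
      ⟨stdBasis n t, (stdBasis n).ne_zero t, fun _ _ => rfl, fun v => by simp⟩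
    have := hQ.scalar_eq h0 hE.vol_eq v
    refine Eq.trans ?_ this.symm
    exact congrArg (Q (stdVol n) 0) (Subsingleton.elim _ _)
  by_cases hrn : r = n
  · subst hrn
    refine ⟨_, (FormField.isClosed_of_top S.isSmooth_vol).const_smul
      (Q (stdVol r) 0 (stdBasis r)), fun x E hE v => ?_⟩
    rw [hQ.apply_zero_eq_smul_volume hE.vol_eq]
    rfl
  · refine ⟨0, FormField.isClosed_zero, fun x E hE v => ?_⟩
    rw [hQ.apply_zero_eq_zero (Nat.pos_of_ne_zero hr0) hrn]
    rfl

theorem OrientedSpacetime.SolvesMaxwell.exists_isClosed_of_equivariant (hF : S.SolvesMaxwell h F)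
    {L : (ModelSpace n [⋀^Fin p]→L[ℝ] ℝ) →ₗ[ℝ] (ModelSpace n [⋀^Fin r]→ₗ[ℝ] ℝ)}
    (hL : IsEquivariant (minkowski t) L) :
    ∃ K : FormField n M r, K.IsClosed ∧ ∀ x E, S.IsFrame t x E → ∀ v : Fin r → ModelSpace n,
      K x (fun s => E (v s)) = L ((F x).compContinuousLinearMap
        (E : ModelSpace n →L[ℝ] TangentSpace (𝓡 n) x)) v := by
  by_cases hr : r = p
  · subst hr
    obtain ⟨a, ha⟩ := hL.exists_eq_smul
    refine ⟨_, hF.1.const_smul a, fun x E _ v => ?_⟩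
    rw [ha]
    rfl
  · refine ⟨0, FormField.isClosed_zero, fun x E _ v => ?_⟩
    rw [hL.eq_zero hr]
    rfl

/-- The sign `s` is the orientation of the frame. The components of `*F` are `s` times the standard
dual of the components of `F`, so an orientation-odd map yields a multiple of `*F` on the spacetime,
and this is where `d*F = 0` is used. -/
theorem OrientedSpacetime.SolvesMaxwell.exists_isClosed_of_twistedEquivariant
    (hF : S.SolvesMaxwell h F)
    {L : (ModelSpace n [⋀^Fin p]→L[ℝ] ℝ) →ₗ[ℝ] (ModelSpace n [⋀^Fin r]→ₗ[ℝ] ℝ)}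
    (hL : IsTwistedEquivariant t L) :
    ∃ K : FormField n M r, K.IsClosed ∧ ∀ x E, S.IsFrame t x E → ∀ (s : ℝ),
      (S.vol x).compContinuousLinearMap (E : ModelSpace n →L[ℝ] TangentSpace (𝓡 n) x) =
        s • stdVol n → ∀ v : Fin r → ModelSpace n,
      K x (fun s => E (v s)) = s * L ((F x).compContinuousLinearMap
        (E : ModelSpace n →L[ℝ] TangentSpace (𝓡 n) x)) v := by
  by_cases hr : r = q
  · subst hr
    obtain ⟨b, hb⟩ := hL.exists_eq_smul h
    refine ⟨_, hF.2.const_smul b, fun x E hE s hs v => ?_⟩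
    have h1 := Represents.star (P := fun _ F => F) (S := S) (t := t) (F := F) (H := F)
      (fun _ _ _ _ => rfl) h x E hE v
    rw [hs] at h1
    have h2 := hodgeLinear_smul_volume h t s (stdVol n) ((F x).compContinuousLinearMap
      (E : ModelSpace n →L[ℝ] TangentSpace (𝓡 n) x))
    have h3 : S.star h F x (fun s => E (v s)) = s * hodgeLinear h t (stdVol n)
        ((F x).compContinuousLinearMap (E : ModelSpace n →L[ℝ] TangentSpace (𝓡 n) x)) v :=
      h1.trans (congrArg (fun G : ModelSpace n [⋀^Fin r]→L[ℝ] ℝ => G v) h2)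
    rw [hb]
    change b * S.star h F x (fun s => E (v s)) = s * (b * _)
    rw [h3, mul_left_comm]
    rfl
  · refine ⟨0, FormField.isClosed_zero, fun x E _ s _ v => ?_⟩
    rw [hL.eq_zero h hr]
    exact (mul_zero s).symm

/-- A representing operation is known to be alternating only at the arguments that occur in frames.
Antisymmetrizing makes it alternating for all arguments, as the linearization requires, without
changing the values that occur. -/
theorem OrientedSpacetime.Represents.antisymmetrize {H : FormField n M r}
    {P : (ModelSpace n [⋀^Fin n]→L[ℝ] ℝ) → (ModelSpace n [⋀^Fin p]→L[ℝ] ℝ) →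
      CovTensor r (ModelSpace n)} (hP : S.Represents t F H.toTensor P) :
    S.Represents t F H.toTensor
      fun ε G => (IsNaturalOperation.antisymmetrize P ε G).toMultilinearMap := by
  intro x E hE v
  have h : IsNaturalOperation.antisymmetrize P _ _ = ((H x).compContinuousLinearMap
      (E : ModelSpace n →L[ℝ] TangentSpace (𝓡 n) x)).toAlternatingMap :=
    IsNaturalOperation.antisymmetrize_of_alternating
      (MultilinearMap.ext fun v => (hP x E hE v).symm)
  beta_reduce
  rw [h]
  rfl

/-- The forms that are computed by a natural operation from a null solution of the Maxwell
equations are closed. -/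
theorem OrientedSpacetime.Represents.isClosed (hnull : S.IsNull F) (hF : S.SolvesMaxwell h F)
    {H : FormField n M r}
    {Q : (ModelSpace n [⋀^Fin n]→L[ℝ] ℝ) → (ModelSpace n [⋀^Fin p]→L[ℝ] ℝ) →
      (ModelSpace n [⋀^Fin r]→ₗ[ℝ] ℝ)}
    (hQ : IsNaturalOperation t fun ε F => (Q ε F).toMultilinearMap)
    (hQH : S.Represents t F H.toTensor fun ε F => (Q ε F).toMultilinearMap) : H.IsClosed := by
  obtain ⟨K₀, hK₀, h₀⟩ := S.exists_isClosed_apply_zero hQ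
  obtain ⟨K₁, hK₁, h₁⟩ := hF.exists_isClosed_of_equivariant hQ.evenPart_equivariant
  obtain ⟨K₂, hK₂, h₂⟩ := hF.exists_isClosed_of_twistedEquivariant hQ.oddPart_twistedEquivariant
  -- The three summands are the value at `0`, the even and the odd part of the linearization. The
  -- sign of the frame recombines the last two into the linearization at the actual volume form.
  have hH : H = K₀ + K₁ + K₂ := by
    refine IsFrame.ext S t fun x E hE v => ?_
    have h3 := hQH x E hE v
    beta_reduce at h3
    rw [hQ.eq_add_linearize _ (hE.isNullAt (hnull x))] at h3
    refine h3.trans ?_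
    change Q _ 0 v + hQ.linearize _ _ v = K₀ x (fun s => E (v s)) + K₁ x (fun s => E (v s)) +
      K₂ x fun s => E (v s)
    rw [h₀ x E hE, h₁ x E hE, hQ.evenPart_apply]
    rcases hE.vol_eq with h4 | h4
    · rw [h₂ x E hE 1 (by rw [h4, one_smul]), hQ.oddPart_apply, h4]
      ring
    · rw [h₂ x E hE (-1) (by rw [h4]; ext; simp), hQ.oddPart_apply, h4]
      ring
  rw [hH]
  exact (hK₀.add hK₁).add hK₂

end Frames

end

theorem proposition2p4 {n p q : ℕ} (h : p + q = n)
    {M : Type*} [TopologicalSpace M] [ChartedSpace (ModelSpace n) M] [IsManifold (𝓡 n) ∞ M]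
    (S : OrientedSpacetime n M) (F : FormField n M p)
    (hnull : S.IsNull F) (hMaxwell : S.SolvesMaxwell h F) :
    S.IsZeroUniversal h F ∧
      ∀ G : FormField n M p, S.AlgebraicPolynomial h F G.toTensor →
        G.IsClosed ∧ (S.star h G).IsClosed := by
  have key : ∀ G : FormField n M p, S.AlgebraicPolynomial h F G.toTensor →
      G.IsClosed ∧ (S.star h G).IsClosed := by
    intro G hG
    rcases isEmpty_or_nonempty M with _ | ⟨⟨x⟩⟩
    -- On the empty manifold there may be no index `t` at all (`n = 0`). A point supplies one
    -- through the signature.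
    · exact ⟨G.isClosed_of_isEmpty, (S.star h G).isClosed_of_isEmpty⟩
    obtain ⟨t, -⟩ := S.lorentzian x
    obtain ⟨P, hP, hPG⟩ := hG.exists_represents hnull t
    have hQ : IsNaturalOperation t fun ε F =>
        (toContinuousForm (IsNaturalOperation.antisymmetrize P ε F)).toMultilinearMap :=
      hP.antisymmetrized
    have hQG : S.Represents t F G.toTensor fun ε F =>
        (toContinuousForm (IsNaturalOperation.antisymmetrize P ε F)).toMultilinearMap :=
      hPG.antisymmetrize
    -- `*G` is itself computed by a natural operation, with values in `q`-forms, so the same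
    -- closedness result covers both assertions.
    exact ⟨hPG.antisymmetrize.isClosed hnull hMaxwell hP.antisymmetrized,
      (hQG.star h).isClosed hnull hMaxwell
        (Q := fun ε F => (hodgeDual h (stdBasis n) (minkowski t) ε
          (toContinuousForm (IsNaturalOperation.antisymmetrize P ε F))).toAlternatingMap)
        (hQ.hodge h)⟩
  exact ⟨⟨hMaxwell.1, fun G hG => (key G hG).2⟩, key⟩
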